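/- Fix $0<p<1$ and let $q=1-p$. Let $G_{n,p}$ be the random graph on the vertex set $\{1,\dots,n\}$ in which each of the $\binom n2$ possible edges is present independently with probability $p$. For a finite graph $G$ and a real number $t\ge 0$, a set $S$ of vertices is called $t$-dependent if the subgraph of $G$ induced by $S$ has maximum degree at most $t$, and the $t$-improper chromatic number $\chi^t(G)$ is the least number of colours in a colouring of the vertices of $G$ in which every colour class is $t$-dependent. Let \[ \Lambda^*(x) = x\ln\frac{x}{p} + (1-x)\ln\frac{1-x}{q}\qquad (0\le x\le 1), \] with $\Lambda^*(0)=\ln(1/q)$ and $\Lambda^*(1)=\ln(1/p)$. For $\tau\ge 0$ let $\kappa_p(\tau)$ be the unique real number greater than $\tau/p$ such that \[ \frac{\kappa}{2}\,\Lambda^*\!\left(\frac{\tau}{\kappa}\right) \begin{cases} <1 & \text{if } \tau/p<\kappa<\kappa_p(\tau),\\ =1 & \text{if } \kappa=\kappa_p(\tau),\\ >1 & \text{if } \kappa>\kappa_p(\tau).\end{cases} \] Let $t=t(n)\ge 0$ be a sequence of real numbers with $t(n)/\ln n\to\tau$ as $n\to\infty$, for some fixed $\tau\ge 0$. Then $\chi^t(G_{n,p})\sim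 \dfrac{n}{\kappa_p(\tau)\ln n}$ asymptotically almost surely; that is, for every $\varepsilon>0$, \[ \Pr\left((1-\varepsilon)\frac{n}{\kappa_p(\tau)\ln n}\le \chi^{t(n)}(G_{n,p})\le (1+\varepsilon)\frac{n}{\kappa_p(\tau)\ln n}\right)\to 1\qquad\text{as } n\to\infty . \] -/

import Mathlib

open Filter Topology MeasureTheory

namespace ImproperColouring

open Classical in
/-- A set `S` of vertices is `t`-dependent in `G` if the subgraph of `G` induced by `S` has maximum
degree at most `t`. Here `t` may be any non-negative real number. -/
def IsDependent {V : Type*} [Fintype V] (G : SimpleGraph V) (t : ℝ) (S : Set V) : Prop :=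
  ((G.induce S).maxDegree : ℝ) ≤ t

/-- A colouring of the vertices with `k` colours is `t`-improper if every colour class is
`t`-dependent. -/
def IsImproperColouring {V : Type*} [Fintype V] (G : SimpleGraph V) (t : ℝ) {k : ℕ}
    (c : V → Fin k) : Prop :=
  ∀ i : Fin k, IsDependent G t (c ⁻¹' {i})

/-- The `t`-improper chromatic number: the least number of colours in a `t`-improper colouring. -/
noncomputable def improperChromaticNumber {V : Type*} [Fintype V] (G : SimpleGraph V) (t : ℝ) :
    ℕ :=
  sInf {k : ℕ | ∃ c : V → Fin k, IsImproperColouring G t c}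

/-- For `t ≥ 0`, the set of numbers of colours in `improperChromaticNumber` is non-empty. -/
theorem exists_improperColouring {V : Type*} [Fintype V] (G : SimpleGraph V) {t : ℝ}
    (ht : 0 ≤ t) : {k : ℕ | ∃ c : V → Fin k, IsImproperColouring G t c}.Nonempty := by
  classical
  refine ⟨Fintype.card V, Fintype.equivFin V, fun i => ?_⟩
  unfold IsDependent
  refine le_trans ?_ ht
  norm_cast
  refine SimpleGraph.maxDegree_le_of_forall_degree_le _ _ fun v => ?_
  rw [Nat.le_zero, ← SimpleGraph.card_neighborFinset_eq_degree, Finset.card_eq_zero,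
    Finset.eq_empty_iff_forall_notMem]
  intro w hw
  rw [SimpleGraph.mem_neighborFinset] at hw
  refine hw.ne (Subtype.ext ((Fintype.equivFin V).injective ?_))
  have h1 : (Fintype.equivFin V) v.1 = i := v.2
  have h2 : (Fintype.equivFin V) w.1 = i := w.2
  rw [h1, h2]

/-- The function `Λ*(x) = x ln (x / p) + (1 - x) ln ((1 - x) / (1 - p))` on `[0, 1]`. With
`Real.log 0 = 0` the values at the endpoints are `Λ*(0) = ln (1 / (1 - p))` and
`Λ*(1) = ln (1 / p)`. It is used below only at points of `[0, p)`, so its values outside `[0, 1]`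
play no role. -/
noncomputable def rate (p x : ℝ) : ℝ :=
  x * Real.log (x / p) + (1 - x) * Real.log ((1 - x) / (1 - p))

/-- The property that defines `κ_p(τ)`. -/
def IsKappa (p τ κ₀ : ℝ) : Prop :=
  τ / p < κ₀ ∧
    (∀ κ : ℝ, τ / p < κ → κ < κ₀ → κ / 2 * rate p (τ / κ) < 1) ∧
    κ₀ / 2 * rate p (τ / κ₀) = 1 ∧
    (∀ κ : ℝ, κ₀ < κ → 1 < κ / 2 * rate p (τ / κ))

theorem rate_eq {p : ℝ} (hp0 : 0 < p) (hp1 : p < 1) (x : ℝ) :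
    rate p x = x * Real.log x - x * Real.log p
      + ((1 - x) * Real.log (1 - x) - (1 - x) * Real.log (1 - p)) := by
  have key : ∀ y r : ℝ, 0 < r → y * Real.log (y / r) = y * Real.log y - y * Real.log r := by
    intro y r hr
    rcases eq_or_ne y 0 with rfl | hy
    · simp
    · rw [Real.log_div hy hr.ne']; ring
  rw [rate, key x p hp0, key (1 - x) (1 - p) (by linarith)]

theorem continuous_rate {p : ℝ} (hp0 : 0 < p) (hp1 : p < 1) : Continuous (rate p) := by
  have h : rate p = fun x => x * Real.log x - x * Real.log p
      + ((1 - x) * Real.log (1 - x) - (1 - x) * Real.log (1 - p)) :=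
    funext (rate_eq hp0 hp1)
  rw [h]
  have h1 := Real.continuous_mul_log
  have h2 : Continuous fun x : ℝ => (1 - x) * Real.log (1 - x) :=
    h1.comp (continuous_const.sub continuous_id)
  fun_prop

theorem kappa_aux_eq {p τ κ : ℝ} (hp0 : 0 < p) (hp1 : p < 1) (hτ : 0 ≤ τ) (hκ : τ / p < κ) :
    κ / 2 * rate p (τ / κ) = (τ * (Real.log τ - Real.log p - Real.log κ)
      + (κ - τ) * (Real.log (κ - τ) - Real.log κ - Real.log (1 - p))) / 2 := by
  have hκ0 : 0 < κ := lt_of_le_of_lt (by positivity) hκ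
  have hτκ : 0 < κ - τ := by
    rw [div_lt_iff₀ hp0] at hκ
    nlinarith
  rw [rate_eq hp0 hp1, one_sub_div hκ0.ne', Real.log_div hτκ.ne' hκ0.ne']
  rcases hτ.eq_or_lt with rfl | hτ0
  · field_simp; simp
  · rw [Real.log_div hτ0.ne' hκ0.ne']
    field_simp
    ring

theorem kappa_strictMonoOn {p τ : ℝ} (hp0 : 0 < p) (hp1 : p < 1) (hτ : 0 ≤ τ) :
    StrictMonoOn (fun κ => κ / 2 * rate p (τ / κ)) (Set.Ioi (τ / p)) := by
  suffices h : StrictMonoOn (fun κ => (τ * (Real.log τ - Real.log p - Real.log κ)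
      + (κ - τ) * (Real.log (κ - τ) - Real.log κ - Real.log (1 - p))) / 2) (Set.Ioi (τ / p)) from
    h.congr fun κ hκ => (kappa_aux_eq hp0 hp1 hτ hκ).symm
  have hd : ∀ κ ∈ Set.Ioi (τ / p), HasDerivAt
      (fun κ => (τ * (Real.log τ - Real.log p - Real.log κ)
        + (κ - τ) * (Real.log (κ - τ) - Real.log κ - Real.log (1 - p))) / 2)
      ((Real.log (κ - τ) - Real.log κ - Real.log (1 - p)) / 2) κ := by
    intro κ hκ
    have hκ' : τ / p < κ := hκ
    have hκ0 : 0 < κ := lt_of_le_of_lt (by positivity) hκ'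
    have hτκ : 0 < κ - τ := by
      rw [div_lt_iff₀ hp0] at hκ'
      nlinarith
    have h1 := Real.hasDerivAt_log hκ0.ne'
    have h0 := (hasDerivAt_id' κ).sub_const τ
    have h2 := h0.log hτκ.ne'
    have h3 := (((h1.const_sub (Real.log τ - Real.log p)).const_mul τ).add
      (h0.mul ((h2.sub h1).sub_const (Real.log (1 - p))))).div_const 2
    refine h3.congr_deriv ?_
    simp only [Pi.sub_apply]
    field_simp
    ring
  refine strictMonoOn_of_deriv_pos (convex_Ioi _)
    (fun κ hκ => (hd κ hκ).continuousAt.continuousWithinAt) fun κ hκ => ?_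
  rw [interior_Ioi] at hκ
  rw [(hd κ hκ).deriv]
  have hκ' : τ / p < κ := hκ
  have hκ0 : 0 < κ := lt_of_le_of_lt (by positivity) hκ'
  rw [div_lt_iff₀ hp0] at hκ'
  have h : Real.log (κ * (1 - p)) < Real.log (κ - τ) :=
    Real.log_lt_log (mul_pos hκ0 (by linarith)) (by linarith)
  rw [Real.log_mul hκ0.ne' (by linarith)] at h
  linarith

/-- Existence and uniqueness of `κ_p(τ)`. -/
theorem existsUnique_isKappa {p τ : ℝ} (hp0 : 0 < p) (hp1 : p < 1) (hτ : 0 ≤ τ) :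
    ∃! κ : ℝ, IsKappa p τ κ := by
  have hmono := kappa_strictMonoOn hp0 hp1 hτ
  set f : ℝ → ℝ := fun κ => κ / 2 * rate p (τ / κ) with hf
  have h0 : 0 ≤ τ / p := by positivity
  have hpos : ∀ κ ∈ Set.Ioi (τ / p), κ ≠ 0 := fun κ hκ => (lt_of_le_of_lt h0 hκ).ne'
  have hcr := continuous_rate hp0 hp1
  have hcont : ContinuousOn f (Set.Ioi (τ / p)) :=
    (continuousOn_id.div_const 2).mul
      (hcr.comp_continuousOn (continuousOn_const.div continuousOn_id hpos))
  have hlow : ∃ a ∈ Set.Ioi (τ / p), f a < 1 := by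
    have ht : Tendsto f (𝓝[>] (τ / p)) (𝓝 0) := by
      rcases hτ.eq_or_lt with rfl | hτ0
      · have : f = fun κ => κ / 2 * rate p 0 := by funext κ; simp [hf]
        rw [this]
        have hc : Continuous fun κ : ℝ => κ / 2 * rate p 0 := by fun_prop
        simpa using (hc.tendsto (0 / p)).mono_left nhdsWithin_le_nhds
      · have hne : τ / p ≠ 0 := by positivity
        have hc : ContinuousAt f (τ / p) :=
          (continuousAt_id.div_const 2).mul
            (hcr.continuousAt.comp (continuousAt_const.div continuousAt_id hne))
        have hv : f (τ / p) = 0 := by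
          have : τ / (τ / p) = p := by field_simp
          have hq : (1 - p) ≠ 0 := by linarith
          simp [hf, this, rate, hp0.ne', hq]
        have := hc.tendsto
        rw [hv] at this
        exact this.mono_left nhdsWithin_le_nhds
    obtain ⟨a, ha, ha'⟩ :=
      ((ht.eventually (gt_mem_nhds one_pos)).and self_mem_nhdsWithin).exists
    exact ⟨a, ha', ha⟩
  have hhigh : ∃ b ∈ Set.Ioi (τ / p), 1 < f b := by
    have hr0 : 0 < rate p 0 := by
      have : Real.log (1 - p) < 0 := Real.log_neg (by linarith) (by linarith)
      simp [rate]
      exact this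
    have h1 : Tendsto (fun κ : ℝ => rate p (τ / κ)) atTop (𝓝 (rate p 0)) :=
      (hcr.tendsto 0).comp (tendsto_const_nhds.div_atTop tendsto_id)
    have ht : Tendsto f atTop atTop :=
      (tendsto_id.atTop_div_const two_pos).atTop_mul_pos hr0 h1
    obtain ⟨b, hb, hb'⟩ :=
      ((ht.eventually (eventually_gt_atTop 1)).and (eventually_gt_atTop (τ / p))).exists
    exact ⟨b, hb', hb⟩
  obtain ⟨a, ha, hfa⟩ := hlow
  obtain ⟨b, hb, hfb⟩ := hhigh
  obtain ⟨c, hc, hfc⟩ := (isPreconnected_Ioi (a := τ / p)).intermediate_value ha hb hcont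
    ⟨hfa.le, hfb.le⟩
  refine ⟨c, ⟨hc, fun κ h1 h2 => ?_, hfc, fun κ h => ?_⟩, fun d hd => ?_⟩
  · rw [← hfc]; exact hmono h1 hc h2
  · rw [← hfc]; exact hmono hc (lt_trans hc h) h
  · exact hmono.injOn hd.1 hc (hd.2.2.1.trans hfc.symm)

open Classical in
/-- The number `κ_p(τ)`, for `0 < p < 1` and `τ ≥ 0`. -/
noncomputable def kappa (p τ : ℝ) : ℝ :=
  if h : ∃ κ : ℝ, IsKappa p τ κ then h.choose else 0

/-- `kappa p τ` has the property that defines it. -/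
theorem kappa_spec {p τ : ℝ} (hp0 : 0 < p) (hp1 : p < 1) (hτ : 0 ≤ τ) :
    IsKappa p τ (kappa p τ) := by
  have h := (existsUnique_isKappa hp0 hp1 hτ).exists
  rw [kappa, dif_pos h]
  exact h.choose_spec

/-- `X (G(n,p)) ∼ a n` asymptotically almost surely: for every `ε > 0`, the probability that
`(1 - ε) a n ≤ X (G(n,p)) ≤ (1 + ε) a n` tends to `1`. The random graph `G(n,p)` on `n` labelled
vertices is Mathlib's `SimpleGraph.binomialRandom`. -/
def AsympAAS (p : unitInterval) (X : (n : ℕ) → SimpleGraph (Fin n) → ℝ) (a : ℕ → ℝ) : Prop :=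
  ∀ ε : ℝ, 0 < ε →
    Tendsto (fun n : ℕ => SimpleGraph.binomialRandom (Fin n) p
      {G : SimpleGraph (Fin n) | (1 - ε) * a n ≤ X n G ∧ X n G ≤ (1 + ε) * a n}) atTop (𝓝 1)

end ImproperColouring

/-! Write x = ln n and κ = κ_p(τ). A t-dependent set of k ≈ κ'x vertices has edge density at most
about τ/κ'. By large deviations this has probability about exp(-(k²/2)Λ*(τ/κ')), that is, n to the
power -k·(κ'/2)Λ*(τ/κ'), while there are at most n^k sets of size k. Hence κ is the threshold for
the size, in units of ln n, of the largest t-dependent set.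

Lower bound. Above the threshold the first moment tends to zero (`tendsto_bprob_exists_dependent`),
so no colour class has more than κ(1+ε)x vertices.

Upper bound. Fix κ₁ slightly below κ. If every set W of at least n/x² vertices contains a
t-dependent set of size k = ⌊κ₁x⌋, such sets can be removed greedily as colour classes; the O(n/x²)
vertices left over get a colour each, which is negligible against n/x. A union bound over up to 2^n
sets W needs failure probabilities far below 2^(-n), more than the second moment method alone gives.
The remedy is a packing argument (`bprob_forall_not_good_le`). The maximum number of good k-sets in
W that pairwise share at most one vertex changes by at most 1 when one edge changes. Its mean is at
least n^(9/5)/4, by random sampling and deletion applied to a bound on the expected number of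
overlapping good pairs. With at most n² edge variables, bounded differences give failure probability
at most exp(-n^(8/5)/64).

To control the pairs, "good" means more than t-dependent: every subset with at least L vertices must
have edge density close to a fixed a just below τ/κ₁ (a = 0 when τ = 0). Such a set is typical at
edge density a, so a change of measure bounds its probability from below. When two good sets share l
≥ L vertices, the density condition on the intersection determines the number of edges in the union,
and a change of measure bounds the joint probability. When l < L, the crude factor min(p,
1-p)^(-C(l,2)) suffices. Both cases are in `pow_mul_overlapBound_le`. -/

namespace ImproperColouring

open Finset

set_option linter.unusedSectionVars false

/-! ### Product measures on finite sets: correlation and concentration. -/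

section BernoulliExpectation

variable {α : Type*} [DecidableEq α]

/-- The expectation of `f A`, where `A` is a random subset of `E` that contains each element
independently with probability `p`. -/
def bexp {α : Type*} (E : Finset α) (p : ℝ) (f : Finset α → ℝ) : ℝ :=
  ∑ A ∈ E.powerset, p ^ #A * (1 - p) ^ (#E - #A) * f A

/-- `f A` depends only on `A ∩ D`. -/
def SupportedOn {α β : Type*} [DecidableEq α] (f : Finset α → β) (D : Finset α) : Prop :=
  ∀ a ∉ D, ∀ A, f (insert a A) = f A

theorem SupportedOn.comp_insert {β : Type*} {f : Finset α → β} {D : Finset α}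
    (h : SupportedOn f D) (a : α) : SupportedOn (fun A => f (insert a A)) D := fun b hb A => by
  simp only [Finset.insert_comm a b, h b hb]

theorem supportedOn_inter {β : Type*} (g : Finset α → β) {D D' : Finset α} (hD : D ⊆ D') :
    SupportedOn (fun A => g (A ∩ D)) D' := fun a ha A => by
  simp only [Finset.insert_inter_of_notMem fun h => ha (hD h)]

theorem bexp_empty (p : ℝ) (f : Finset α → ℝ) : bexp ∅ p f = f ∅ := by simp [bexp]

theorem bexp_insert {a : α} {E : Finset α} (ha : a ∉ E) (p : ℝ) (f : Finset α → ℝ) :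
    bexp (insert a E) p f = (1 - p) * bexp E p f + p * bexp E p fun A => f (insert a A) := by
  rw [bexp, sum_powerset_insert ha, bexp, bexp, mul_sum, mul_sum]
  congr 1 <;> refine sum_congr rfl fun A hA => ?_ <;> rw [mem_powerset] at hA
  · rw [card_insert_of_notMem ha, Nat.sub_add_comm (card_le_card hA), pow_succ]
    ring
  · rw [card_insert_of_notMem ha, card_insert_of_notMem fun h => ha (hA h),
      Nat.add_sub_add_right, pow_succ]
    ring

section

variable {E : Finset α} {p : ℝ} {f g : Finset α → ℝ}

theorem bexp_congr (h : ∀ A ⊆ E, f A = g A) : bexp E p f = bexp E p g :=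
  sum_congr rfl fun A hA => by rw [h A (mem_powerset.1 hA)]

theorem bexp_weight_nonneg (hp0 : 0 ≤ p) (hp1 : p ≤ 1) (k l : ℕ) : 0 ≤ p ^ k * (1 - p) ^ l :=
  mul_nonneg (pow_nonneg hp0 _) (pow_nonneg (by linarith) _)

theorem bexp_mono (hp0 : 0 ≤ p) (hp1 : p ≤ 1) (h : ∀ A ⊆ E, f A ≤ g A) :
    bexp E p f ≤ bexp E p g :=
  sum_le_sum fun A hA => mul_le_mul_of_nonneg_left (h A (mem_powerset.1 hA))
    (bexp_weight_nonneg hp0 hp1 _ _)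

theorem bexp_nonneg (hp0 : 0 ≤ p) (hp1 : p ≤ 1) (h : ∀ A ⊆ E, 0 ≤ f A) : 0 ≤ bexp E p f :=
  sum_nonneg fun A hA => mul_nonneg (bexp_weight_nonneg hp0 hp1 _ _) (h A (mem_powerset.1 hA))

theorem bexp_const (E : Finset α) (p c : ℝ) : bexp E p (fun _ => c) = c := by
  induction E using Finset.induction with
  | empty => rw [bexp_empty]
  | insert a E ha ih => rw [bexp_insert ha, ih]; ring

variable (E p f g) in
theorem bexp_add : bexp E p (fun A => f A + g A) = bexp E p f + bexp E p g := by
  simp only [bexp, mul_add, sum_add_distrib]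

variable (E p f g) in
theorem bexp_sub : bexp E p (fun A => f A - g A) = bexp E p f - bexp E p g := by
  simp only [bexp, mul_sub, sum_sub_distrib]

variable (E p f) in
theorem bexp_mul_left (c : ℝ) : bexp E p (fun A => c * f A) = c * bexp E p f := by
  simp only [bexp, mul_sum]
  exact sum_congr rfl fun A _ => by ring

variable (E p) in
theorem bexp_sum {ι : Type*} (s : Finset ι) (F : ι → Finset α → ℝ) :
    bexp E p (fun A => ∑ i ∈ s, F i A) = ∑ i ∈ s, bexp E p (F i) := by
  simp only [bexp, mul_sum]
  exact sum_comm

theorem bexp_eq_of_supportedOn {D : Finset α} (hf : SupportedOn f D) (hD : D ⊆ E) :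
    bexp E p f = bexp D p f := by
  suffices h : ∀ R : Finset α, Disjoint D R → bexp (D ∪ R) p f = bexp D p f by
    simpa [union_sdiff_of_subset hD] using h (E \ D) disjoint_sdiff
  intro R
  induction R using Finset.induction with
  | empty => simp
  | insert a R ha ih =>
    intro hR
    rw [disjoint_insert_right] at hR
    rw [union_insert, bexp_insert (by simp [ha, hR.1]), ih hR.2]
    simp only [hf a hR.1, ih hR.2]
    ring

theorem exists_bexp_le (hp0 : 0 ≤ p) (hp1 : p ≤ 1) (E : Finset α) (f : Finset α → ℝ) :
    ∃ A ⊆ E, bexp E p f ≤ f A := by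
  induction E using Finset.induction generalizing f with
  | empty => exact ⟨∅, subset_rfl, (bexp_empty p f).le⟩
  | insert a E ha ih =>
    obtain ⟨A, hA, h1⟩ := ih f
    obtain ⟨B, hB, h2⟩ := ih fun A => f (insert a A)
    rw [bexp_insert ha]
    rcases le_total (f A) (f (insert a B)) with h | h
    · exact ⟨insert a B, insert_subset_insert _ hB, by nlinarith⟩
    · exact ⟨A, hA.trans (subset_insert _ _), by nlinarith⟩

/-- Two functions that share the coordinates in `D` are correlated by at most a factor
`c ^ (-#D)`. -/
theorem bexp_mul_le {c : ℝ} (hc0 : 0 ≤ c) (hcp : c ≤ p) (hcq : c ≤ 1 - p)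
    {D₁ D₂ : Finset α} (hf : SupportedOn f D₁) (hg : SupportedOn g D₂)
    (hf0 : ∀ A, 0 ≤ f A) (hg0 : ∀ A, 0 ≤ g A) (E : Finset α) :
    c ^ #(E ∩ (D₁ ∩ D₂)) * bexp E p (fun A => f A * g A) ≤ bexp E p f * bexp E p g := by
  have hp0 : 0 ≤ p := hc0.trans hcp
  have hp1 : p ≤ 1 := by linarith
  have hnn : ∀ (E : Finset α) (f : Finset α → ℝ), (∀ A, 0 ≤ f A) → 0 ≤ bexp E p f :=
    fun E f h => bexp_nonneg hp0 hp1 fun A _ => h A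
  induction E using Finset.induction generalizing f g with
  | empty => simp [bexp_empty]
  | insert a E ha ih =>
    have h00 := ih hf hg hf0 hg0
    have h11 := ih (hf.comp_insert a) (hg.comp_insert a) (fun A => hf0 _) (fun A => hg0 _)
    rw [bexp_insert ha, bexp_insert ha, bexp_insert ha]
    by_cases h1 : a ∈ D₁
    · by_cases h2 : a ∈ D₂
      -- For a shared coordinate, the cross terms in the product of the expectations are dropped,
      -- and one factor `p` or `1 - p` in each remaining term is bounded below by `c`. If a
      -- coordinate is not shared, one of the two functions ignores it and nothing is lost.
      · rw [insert_inter_of_mem (by simp [h1, h2]), card_insert_of_notMem (by simp [ha]), pow_succ]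
        have i1 := hnn E f hf0
        have i2 := hnn E g hg0
        have i3 := hnn E (fun A => f (insert a A)) (fun A => hf0 _)
        have i4 := hnn E (fun A => g (insert a A)) (fun A => hg0 _)
        have hq : 0 ≤ 1 - p := by linarith
        have j1 := mul_le_mul_of_nonneg_left h00 (mul_nonneg hc0 hq)
        have j2 := mul_le_mul_of_nonneg_left h11 (mul_nonneg hc0 hp0)
        have k1 : c * (1 - p) * (bexp E p f * bexp E p g)
            ≤ (1 - p) * (1 - p) * (bexp E p f * bexp E p g) :=
          mul_le_mul_of_nonneg_right (mul_le_mul_of_nonneg_right hcq hq) (mul_nonneg i1 i2)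
        have k2 := mul_le_mul_of_nonneg_right (mul_le_mul_of_nonneg_right hcp hp0)
          (mul_nonneg i3 i4)
        have l1 := mul_nonneg (mul_nonneg hq hp0) (mul_nonneg i1 i4)
        have l2 := mul_nonneg (mul_nonneg hq hp0) (mul_nonneg i3 i2)
        nlinarith
      · have h01 := ih hf (hg.comp_insert a) hf0 (fun A => hg0 _)
        rw [insert_inter_of_notMem (by simp [h2])]
        simp only [hg a h2] at h11 ⊢
        nlinarith
    · rw [insert_inter_of_notMem (by simp [h1])]
      simp only [hf a h1] at h11 ⊢
      nlinarith

/-- Condition on one element at a time. The two conditional means differ by at most 1, so each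
element costs a factor of at most 1 + s² ≤ exp(s²). -/
theorem bexp_exp_sub_le (hp0 : 0 ≤ p) (hp1 : p ≤ 1) {s : ℝ} (hs : |s| ≤ 1)
    (hf : ∀ a A, |f (insert a A) - f A| ≤ 1) (E : Finset α) :
    bexp E p (fun A => Real.exp (s * (f A - bexp E p f))) ≤ Real.exp (s ^ 2 * #E) := by
  induction E using Finset.induction generalizing f with
  | empty => simp [bexp_empty]
  | insert a E ha ih =>
    have h0 := ih hf
    have h1 := ih (f := fun A => f (insert a A)) fun b A => by
      simp only [insert_comm a b]; exact hf _ _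
    set m₀ := bexp E p f with hm₀
    set m₁ := bexp E p fun A => f (insert a A) with hm₁
    have hm : |m₁ - m₀| ≤ 1 := by
      rw [hm₁, hm₀, ← bexp_sub, abs_le]
      constructor
      · rw [← bexp_const E p (-1)]
        exact bexp_mono hp0 hp1 fun A _ => (abs_le.1 (hf a A)).1
      · rw [← bexp_const E p 1]
        exact bexp_mono hp0 hp1 fun A _ => (abs_le.1 (hf a A)).2
    rw [bexp_insert ha p f, ← hm₀, ← hm₁, bexp_insert ha]
    set m := (1 - p) * m₀ + p * m₁ with hmm
    have e0 : bexp E p (fun A => Real.exp (s * (f A - m))) = Real.exp (s * (m₀ - m)) *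
        bexp E p (fun A => Real.exp (s * (f A - m₀))) := by
      rw [← bexp_mul_left]
      exact bexp_congr fun A _ => by rw [← Real.exp_add]; congr 1; ring
    have e1 : bexp E p (fun A => Real.exp (s * (f (insert a A) - m))) = Real.exp (s * (m₁ - m)) *
        bexp E p (fun A => Real.exp (s * (f (insert a A) - m₁))) := by
      rw [← bexp_mul_left]
      exact bexp_congr fun A _ => by rw [← Real.exp_add]; congr 1; ring
    have hq : 0 ≤ 1 - p := by linarith
    have d0 : m₀ - m = -(p * (m₁ - m₀)) := by rw [hmm]; ring
    have d1 : m₁ - m = (1 - p) * (m₁ - m₀) := by rw [hmm]; ring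
    -- The linear terms cancel on averaging, because `m` is the mean of `m₀` and `m₁`.
    have key : ∀ x : ℝ, |x| ≤ 1 → Real.exp (s * x) ≤ 1 + s * x + s ^ 2 := fun x hx => by
      have hsx : |s * x| ≤ 1 := by rw [abs_mul]; exact mul_le_one₀ hs (abs_nonneg _) hx
      have := (abs_le.1 (Real.abs_exp_sub_one_sub_id_le hsx)).2
      have hx2 : x ^ 2 ≤ 1 := (sq_le_one_iff_abs_le_one x).2 hx
      have : (s * x) ^ 2 ≤ s ^ 2 := by rw [mul_pow]; exact mul_le_of_le_one_right (sq_nonneg s) hx2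
      linarith
    have a0 : |m₀ - m| ≤ 1 := by
      rw [d0, abs_neg, abs_mul, abs_of_nonneg hp0]; exact mul_le_one₀ hp1 (abs_nonneg _) hm
    have a1 : |m₁ - m| ≤ 1 := by
      rw [d1, abs_mul, abs_of_nonneg hq]; exact mul_le_one₀ (by linarith) (abs_nonneg _) hm
    rw [e0, e1, card_insert_of_notMem ha]
    have hE := Real.exp_nonneg (s ^ 2 * #E)
    calc (1 - p) * (Real.exp (s * (m₀ - m)) * _) + p * (Real.exp (s * (m₁ - m)) * _)
        ≤ (1 - p) * ((1 + s * (m₀ - m) + s ^ 2) * Real.exp (s ^ 2 * #E))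
          + p * ((1 + s * (m₁ - m) + s ^ 2) * Real.exp (s ^ 2 * #E)) := by
          have b0 := (Real.exp_pos (s * (m₀ - m))).le.trans (key _ a0)
          have b1 := (Real.exp_pos (s * (m₁ - m))).le.trans (key _ a1)
          gcongr
          · exact bexp_nonneg hp0 hp1 fun A _ => (Real.exp_pos _).le
          · exact key _ a0
          · exact bexp_nonneg hp0 hp1 fun A _ => (Real.exp_pos _).le
          · exact key _ a1
      _ = (s ^ 2 + 1) * Real.exp (s ^ 2 * #E) := by rw [d0, d1]; ring
      _ ≤ Real.exp (s ^ 2) * Real.exp (s ^ 2 * #E) := by gcongr; exact Real.add_one_le_exp _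
      _ = Real.exp (s ^ 2 * (#E + 1 : ℕ)) := by rw [← Real.exp_add]; congr 1; push_cast; ring

end

open Classical in
/-- The probability of the event `Q A`, where `A` is a random subset of `E` that contains each
element independently with probability `p`. -/
noncomputable def bprob {α : Type*} (E : Finset α) (p : ℝ) (Q : Finset α → Prop) : ℝ :=
  bexp E p fun A => if Q A then 1 else 0

section

variable {E : Finset α} {p : ℝ} {f : Finset α → ℝ} {Q R : Finset α → Prop}

theorem bprob_nonneg (hp0 : 0 ≤ p) (hp1 : p ≤ 1) : 0 ≤ bprob E p Q :=
  bexp_nonneg hp0 hp1 fun A _ => by split_ifs <;> norm_num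

theorem bprob_mono (hp0 : 0 ≤ p) (hp1 : p ≤ 1) (h : ∀ A ⊆ E, Q A → R A) :
    bprob E p Q ≤ bprob E p R :=
  bexp_mono hp0 hp1 fun A hA => by
    by_cases h1 : Q A
    · simp [h1, h A hA h1]
    · simp only [h1, if_false]; split_ifs <;> norm_num

variable (E p Q) in
theorem bprob_not : bprob E p (fun A => ¬ Q A) = 1 - bprob E p Q := by
  rw [← bexp_const E p 1, bprob, bprob, ← bexp_sub]
  exact bexp_congr fun A _ => by by_cases h : Q A <;> simp [h]

theorem bprob_exists_le (hp0 : 0 ≤ p) (hp1 : p ≤ 1) {ι : Type*} (s : Finset ι)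
    (F : ι → Finset α → Prop) :
    bprob E p (fun A => ∃ i ∈ s, F i A) ≤ ∑ i ∈ s, bprob E p (F i) := by
  classical
  unfold bprob
  rw [← bexp_sum]
  refine bexp_mono hp0 hp1 fun A _ => ?_
  have hnn : ∀ i ∈ s, (0 : ℝ) ≤ (if F i A then 1 else 0) := fun i _ => by split_ifs <;> norm_num
  split_ifs with h
  · obtain ⟨i, hi, hF⟩ := h
    have := single_le_sum hnn hi
    simpa [hF] using this
  · exact sum_nonneg hnn

theorem bprob_or_le (hp0 : 0 ≤ p) (hp1 : p ≤ 1) :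
    bprob E p (fun A => Q A ∨ R A) ≤ bprob E p Q + bprob E p R := by
  unfold bprob
  rw [← bexp_add]
  refine bexp_mono hp0 hp1 fun A _ => ?_
  by_cases h1 : Q A <;> by_cases h2 : R A <;> simp [h1, h2]

theorem SupportedOn.bprob_eq {D : Finset α} (hQ : SupportedOn Q D) (hD : D ⊆ E) :
    bprob E p Q = bprob D p Q := by
  unfold bprob
  exact bexp_eq_of_supportedOn (fun a ha A => by
    have h := hQ a ha A
    by_cases hA : Q A <;> simp [h, hA]) hD

/-- The bounded differences inequality, upper tail. -/
theorem bprob_add_le_le_exp (hp0 : 0 ≤ p) (hp1 : p ≤ 1) (hf : ∀ a A, |f (insert a A) - f A| ≤ 1)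
    {d N : ℝ} (hd : 0 ≤ d) (hN : 0 < N) (hdN : d ≤ 2 * N) (hE : (#E : ℝ) ≤ N) :
    bprob E p (fun A => bexp E p f + d ≤ f A) ≤ Real.exp (-(d ^ 2 / (4 * N))) := by
  -- This minimises -sd + s²N; `hdN` is what makes it at most 1.
  set s := d / (2 * N) with hs
  have hs0 : 0 ≤ s := by positivity
  have hs1 : |s| ≤ 1 := by rw [abs_of_nonneg hs0, hs, div_le_one (by positivity)]; exact hdN
  calc bprob E p (fun A => bexp E p f + d ≤ f A)
      ≤ bexp E p (fun A => Real.exp (-(s * d)) * Real.exp (s * (f A - bexp E p f))) := by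
        refine bexp_mono hp0 hp1 fun A _ => ?_
        rw [← Real.exp_add]
        split_ifs with h
        · refine Real.one_le_exp ?_
          nlinarith
        · positivity
    _ ≤ Real.exp (-(s * d)) * Real.exp (s ^ 2 * #E) := by
        rw [bexp_mul_left]
        gcongr
        exact bexp_exp_sub_le hp0 hp1 hs1 hf E
    _ ≤ Real.exp (-(s * d)) * Real.exp (s ^ 2 * N) := by gcongr
    _ = Real.exp (-(d ^ 2 / (4 * N))) := by
        rw [← Real.exp_add, hs]
        congr 1
        field_simp
        ring

/-- The bounded differences inequality, lower tail. -/
theorem bprob_le_sub_le_exp (hp0 : 0 ≤ p) (hp1 : p ≤ 1) (hf : ∀ a A, |f (insert a A) - f A| ≤ 1)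
    {d N : ℝ} (hd : 0 ≤ d) (hN : 0 < N) (hdN : d ≤ 2 * N) (hE : (#E : ℝ) ≤ N) :
    bprob E p (fun A => f A ≤ bexp E p f - d) ≤ Real.exp (-(d ^ 2 / (4 * N))) := by
  have h := bprob_add_le_le_exp (f := fun A => (-1) * f A) hp0 hp1
    (fun a A => by rw [← abs_neg]; convert hf a A using 2; ring) hd hN hdN hE
  rw [bexp_mul_left] at h
  refine (bprob_mono hp0 hp1 fun A _ hA => ?_).trans h
  linarith

theorem bexp_indicator_mem {a : α} (ha : a ∈ E) :
    bexp E p (fun A => if a ∈ A then 1 else 0) = p := by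
  rw [bexp_eq_of_supportedOn (D := {a}) (fun b hb A => ?_) (by simpa using ha)]
  · rw [← insert_empty_eq, bexp_insert (by simp)]
    simp [bexp_empty]
  · have : a ≠ b := by simpa [eq_comm] using hb
    simp [this]

theorem bexp_indicator_mem_and_mem {a b : α} (hab : a ≠ b) (ha : a ∈ E) (hb : b ∈ E) :
    bexp E p (fun A => if a ∈ A ∧ b ∈ A then 1 else 0) = p ^ 2 := by
  rw [bexp_eq_of_supportedOn (D := {a, b}) (fun c hc A => ?_)
    (by simp [insert_subset_iff, ha, hb])]
  · rw [bexp_insert (by simpa using hab), ← insert_empty_eq, bexp_insert (by simp),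
      bexp_insert (by simp)]
    simp [bexp_empty, hab, hab.symm]
    ring
  · simp only [mem_insert, mem_singleton, not_or] at hc
    simp [Ne.symm hc.1, Ne.symm hc.2]

theorem bexp_card_inter {D : Finset α} (hD : D ⊆ E) :
    bexp E p (fun A => (#(A ∩ D) : ℝ)) = p * #D := by
  have h : ∀ A : Finset α, (#(A ∩ D) : ℝ) = ∑ a ∈ D, if a ∈ A then 1 else 0 := fun A => by
    rw [sum_boole, filter_mem_eq_inter, inter_comm]
  simp only [h]
  rw [bexp_sum, sum_congr rfl fun a ha => bexp_indicator_mem (hD ha), sum_const, nsmul_eq_mul,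
    mul_comm]

theorem abs_card_insert_inter_sub_le (D : Finset α) (a : α) (A : Finset α) :
    |(#(insert a A ∩ D) : ℝ) - #(A ∩ D)| ≤ 1 := by
  have h1 : #(A ∩ D) ≤ #(insert a A ∩ D) :=
    card_le_card (inter_subset_inter_right (subset_insert _ _))
  have h2 : #(insert a A ∩ D) ≤ #(A ∩ D) + 1 := by
    refine (card_le_card (t := insert a (A ∩ D)) ?_).trans (card_insert_le _ _)
    intro x; simp; tauto
  rw [abs_le]
  constructor
  · have : (#(A ∩ D) : ℝ) ≤ #(insert a A ∩ D) := by exact_mod_cast h1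
    linarith
  · have : (#(insert a A ∩ D) : ℝ) ≤ #(A ∩ D) + 1 := by exact_mod_cast h2
    linarith

end

end BernoulliExpectation

/-! ### Change of measure between edge densities. -/

section Tilting

/-- The rate at which the likelihood ratio of `p` and `a` varies with the relative density. -/
noncomputable def tiltConst (p a : ℝ) : ℝ :=
  a * |Real.log (p / a) - Real.log ((1 - p) / (1 - a))|

theorem tiltConst_nonneg {p a : ℝ} (ha : 0 ≤ a) : 0 ≤ tiltConst p a :=
  mul_nonneg ha (abs_nonneg _)

/-- The logarithm of the likelihood ratio is affine in `j`, with value `-(N * rate p a)` at j = aN.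
-/
theorem weight_eq_tilt {p a : ℝ} (hp0 : 0 < p) (hp1 : p < 1) (ha0 : 0 < a) (ha1 : a < 1)
    {j N : ℕ} (hj : j ≤ N) :
    p ^ j * (1 - p) ^ (N - j) = a ^ j * (1 - a) ^ (N - j) * Real.exp (-(N * rate p a)
      + (Real.log (p / a) - Real.log ((1 - p) / (1 - a))) * (j - a * N)) := by
  have hq : 0 < 1 - p := by linarith
  have hb : 0 < 1 - a := by linarith
  have e : ∀ x : ℝ, 0 < x → ∀ n : ℕ, x ^ n = Real.exp (n * Real.log x) := fun x hx n => by
    rw [Real.exp_nat_mul, Real.exp_log hx]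
  rw [e p hp0, e _ hq, e a ha0, e _ hb, ← Real.exp_add, ← Real.exp_add, ← Real.exp_add, rate,
    Real.log_div ha0.ne' hp0.ne', Real.log_div hb.ne' hq.ne', Real.log_div hp0.ne' ha0.ne',
    Real.log_div hq.ne' hb.ne', Nat.cast_sub hj]
  congr 1
  ring

/-- For x ≤ p the likelihood ratio is nondecreasing in `j`, so on j ≤ xN its value at xN is an upper
bound. This is the Chernoff bound for the lower tail. -/
theorem weight_tilt_le {p x : ℝ} (hp0 : 0 < p) (hp1 : p < 1) (hx0 : 0 < x) (hxp : x ≤ p)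
    {j N : ℕ} (hj : j ≤ N) (hjx : (j : ℝ) ≤ x * N) :
    p ^ j * (1 - p) ^ (N - j) ≤ x ^ j * (1 - x) ^ (N - j) * Real.exp (-(N * rate p x)) := by
  rw [weight_eq_tilt hp0 hp1 hx0 (hxp.trans_lt hp1) hj]
  have h1 : 0 ≤ Real.log (p / x) := Real.log_nonneg ((one_le_div hx0).2 hxp)
  have h2 : Real.log ((1 - p) / (1 - x)) ≤ 0 :=
    Real.log_nonpos (div_nonneg (by linarith) (by linarith))
      ((div_le_one (by linarith)).2 (by linarith))
  have : 0 ≤ 1 - x := by linarith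
  gcongr
  nlinarith

/-- The tolerance is proportional to `a`, so a = 0 forces j = 0 and both bounds become equalities.
This lets τ = 0 be treated together with τ > 0. -/
theorem weight_tilt_bounds {p a d : ℝ} (hp0 : 0 < p) (hp1 : p < 1) (ha0 : 0 ≤ a) (ha1 : a < 1)
    {j N : ℕ} (hj : j ≤ N) (hd : |(j : ℝ) - a * N| ≤ a * d) :
    a ^ j * (1 - a) ^ (N - j) * Real.exp (-(N * rate p a) - tiltConst p a * d)
        ≤ p ^ j * (1 - p) ^ (N - j) ∧
      p ^ j * (1 - p) ^ (N - j)
        ≤ a ^ j * (1 - a) ^ (N - j) * Real.exp (-(N * rate p a) + tiltConst p a * d) := by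
  rcases ha0.eq_or_lt with rfl | ha
  · simp only [zero_mul, sub_zero, Nat.abs_cast] at hd
    have hj0 : j = 0 := by
      have := Nat.cast_nonneg (α := ℝ) j
      exact_mod_cast le_antisymm hd this
    subst hj0
    have hr : (1 - p) ^ N = Real.exp (-(N * rate p 0)) := by
      have : -(N * rate p 0) = N * Real.log (1 - p) := by simp [rate]
      rw [this, Real.exp_nat_mul, Real.exp_log (by linarith)]
    simp [tiltConst, hr]
  · rw [weight_eq_tilt hp0 hp1 ha ha1 hj]
    set C := Real.log (p / a) - Real.log ((1 - p) / (1 - a)) with hC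
    have h1 : |C * ((j : ℝ) - a * N)| ≤ tiltConst p a * d := by
      rw [abs_mul, tiltConst, ← hC]
      calc |C| * |(j : ℝ) - a * N| ≤ |C| * (a * d) := by gcongr
        _ = a * |C| * d := by ring
    rw [abs_le] at h1
    have hw := bexp_weight_nonneg ha0 ha1.le j (N - j)
    constructor <;> refine mul_le_mul_of_nonneg_left (Real.exp_le_exp.2 ?_) hw <;> linarith

variable {α : Type*} [DecidableEq α] {E : Finset α} {p : ℝ} {Q : Finset α → Prop}

theorem bprob_card_le_le_exp {x : ℝ} (hp0 : 0 < p) (hp1 : p < 1) (hx0 : 0 < x) (hxp : x ≤ p)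
    (E : Finset α) :
    bprob E p (fun A => (#A : ℝ) ≤ x * #E) ≤ Real.exp (-(#E * rate p x)) := by
  have hx1 : x ≤ 1 := hxp.trans hp1.le
  calc bprob E p (fun A => (#A : ℝ) ≤ x * #E)
      ≤ bexp E x fun _ => Real.exp (-(#E * rate p x)) := by
        refine sum_le_sum fun A hA => ?_
        rw [mem_powerset] at hA
        beta_reduce
        split_ifs with h
        · rw [mul_one]
          exact weight_tilt_le hp0 hp1 hx0 hxp (card_le_card hA) h
        · rw [mul_zero]
          exact mul_nonneg (bexp_weight_nonneg hx0.le hx1 _ _) (Real.exp_pos _).le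
    _ = _ := bexp_const _ _ _

theorem bprob_le_exp_of_tilt {a d : ℝ} (hp0 : 0 < p) (hp1 : p < 1) (ha0 : 0 ≤ a) (ha1 : a < 1)
    (hQ : ∀ A ⊆ E, Q A → |(#A : ℝ) - a * #E| ≤ a * d) :
    bprob E p Q ≤ Real.exp (-(#E * rate p a) + tiltConst p a * d) := by
  calc bprob E p Q ≤ bexp E a fun _ => Real.exp (-(#E * rate p a) + tiltConst p a * d) := by
        refine sum_le_sum fun A hA => ?_
        rw [mem_powerset] at hA
        beta_reduce
        split_ifs with h
        · rw [mul_one]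
          exact (weight_tilt_bounds hp0 hp1 ha0 ha1 (card_le_card hA) (hQ A hA h)).2
        · rw [mul_zero]
          exact mul_nonneg (bexp_weight_nonneg ha0 ha1.le _ _) (Real.exp_pos _).le
    _ = _ := bexp_const _ _ _

/-- Transfers an event that is typical at density `a` to density `p`, where it is rare, at the price
predicted by the rate function. -/
theorem exp_mul_bprob_le_of_tilt {a d : ℝ} (hp0 : 0 < p) (hp1 : p < 1) (ha0 : 0 ≤ a)
    (ha1 : a < 1) (hQ : ∀ A ⊆ E, Q A → |(#A : ℝ) - a * #E| ≤ a * d) :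
    Real.exp (-(#E * rate p a) - tiltConst p a * d) * bprob E a Q ≤ bprob E p Q := by
  rw [bprob, bprob, ← bexp_mul_left]
  refine sum_le_sum fun A hA => ?_
  rw [mem_powerset] at hA
  beta_reduce
  split_ifs with h
  · rw [mul_one, mul_one]
    exact (weight_tilt_bounds hp0 hp1 ha0 ha1 (card_le_card hA) (hQ A hA h)).1
  · simp

theorem bexp_zero (E : Finset α) (f : Finset α → ℝ) : bexp E 0 f = f ∅ := by
  induction E using Finset.induction with
  | empty => exact bexp_empty 0 f
  | insert a E ha ih => rw [bexp_insert ha, ih]; ring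

end Tilting

/-! ### Good vertex sets and their probabilities. -/

section Pairs

variable {V : Type*} [DecidableEq V]

/-- The set of unordered pairs of distinct elements of `S`. -/
def pairs (S : Finset V) : Finset (Sym2 V) := S.sym2.filter fun e => ¬ e.IsDiag

theorem mk_mem_pairs {S : Finset V} {v w : V} : s(v, w) ∈ pairs S ↔ (v ∈ S ∧ w ∈ S) ∧ v ≠ w := by
  simp [pairs]

theorem pairs_mono {S T : Finset V} (h : S ⊆ T) : pairs S ⊆ pairs T :=
  filter_subset_filter _ (sym2_mono h)

theorem pairs_inter (S T : Finset V) : pairs (S ∩ T) = pairs S ∩ pairs T := by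
  ext e
  induction e with | _ v w
  simp only [mem_inter, mk_mem_pairs]
  tauto

theorem card_pairs (S : Finset V) : #(pairs S) = (#S).choose 2 := by
  rw [← Sym2.card_image_offDiag]
  congr 1
  ext e
  induction e with | _ v w
  simp only [mk_mem_pairs, mem_image, mem_offDiag, Prod.exists, Function.uncurry_apply_pair,
    Sym2.eq_iff]
  constructor
  · rintro ⟨⟨h1, h2⟩, h3⟩
    exact ⟨v, w, ⟨h1, h2, h3⟩, Or.inl ⟨rfl, rfl⟩⟩
  · rintro ⟨x, y, ⟨h1, h2, h3⟩, ⟨rfl, rfl⟩ | ⟨rfl, rfl⟩⟩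
    · exact ⟨⟨h1, h2⟩, h3⟩
    · exact ⟨⟨h2, h1⟩, h3.symm⟩

/-- The pairs in `S` that contain `v`. -/
def star (S : Finset V) (v : V) : Finset (Sym2 V) := (S.erase v).image fun w => s(v, w)

theorem star_subset_pairs {S : Finset V} {v : V} (hv : v ∈ S) : star S v ⊆ pairs S := by
  intro e he
  obtain ⟨w, hw, rfl⟩ := mem_image.1 he
  rw [mem_erase] at hw
  exact mk_mem_pairs.2 ⟨⟨hv, hw.2⟩, hw.1.symm⟩

theorem card_star {S : Finset V} {v : V} (hv : v ∈ S) : #(star S v) = #S - 1 := by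
  rw [star, card_image_of_injective _ (fun x y h => Sym2.congr_right.1 h), card_erase_of_mem hv]

/-- `S` is good for the edge set `A` if all degrees in `S` are at most `t` and all subsets of `S`
with at least `L` elements have edge density about `a`. -/
def IsGood (t a δ : ℝ) (L : ℕ) (S : Finset V) (A : Finset (Sym2 V)) : Prop :=
  (∀ v ∈ S, (#(A ∩ star S v) : ℝ) ≤ t) ∧
    ∀ U ⊆ S, L ≤ #U → |(#(A ∩ pairs U) : ℝ) - a * #(pairs U)| ≤ a * (δ * #(pairs U))

variable {t a δ : ℝ} {L : ℕ} {S T : Finset V}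

theorem isGood_supportedOn : SupportedOn (IsGood t a δ L S) (pairs S) := by
  intro e he A
  have h1 : ∀ v ∈ S, insert e A ∩ star S v = A ∩ star S v := fun v hv =>
    insert_inter_of_notMem fun h => he (star_subset_pairs hv h)
  have h2 : ∀ U ⊆ S, insert e A ∩ pairs U = A ∩ pairs U := fun U hU =>
    insert_inter_of_notMem fun h => he (pairs_mono hU h)
  refine propext (and_congr (forall₂_congr fun v hv => by rw [h1 v hv])
    (forall₂_congr fun U hU => by rw [h2 U hU]))

variable {p : ℝ} {E : Finset (Sym2 V)}

theorem exp_mul_bprob_isGood_le (hp0 : 0 < p) (hp1 : p < 1) (ha0 : 0 ≤ a) (ha1 : a < 1)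
    (hL : L ≤ #S) (hE : pairs S ⊆ E) :
    Real.exp (-((#S).choose 2 * (rate p a + tiltConst p a * δ))) *
      bprob (pairs S) a (IsGood t a δ L S) ≤ bprob E p (IsGood t a δ L S) := by
  rw [isGood_supportedOn.bprob_eq hE]
  have h := exp_mul_bprob_le_of_tilt (E := pairs S) (Q := IsGood t a δ L S)
    (d := δ * #(pairs S)) hp0 hp1 ha0 ha1 fun A hA hG => by
      have := hG.2 S subset_rfl hL
      rwa [inter_eq_left.2 hA] at this
  rw [card_pairs] at h
  convert h using 3
  ring

/-- Inclusion–exclusion writes the number of edges in the union as e(S) + e(T) - e(S ∩ T). All three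
are near density `a`, the last because the intersection has at least `L` vertices; their errors add
up to the factor 3. Tilting on the union then gives the bound. -/
theorem bprob_isGood_and_isGood_le (hp0 : 0 < p) (hp1 : p < 1) (ha0 : 0 ≤ a) (ha1 : a < 1)
    (hδ : 0 ≤ δ) (hST : #T = #S) (hL : L ≤ #(S ∩ T)) (hS : pairs S ⊆ E) (hT : pairs T ⊆ E) :
    bprob E p (fun A => IsGood t a δ L S A ∧ IsGood t a δ L T A) ≤
      Real.exp (-((2 * (#S).choose 2 - (#(S ∩ T)).choose 2) * rate p a)
        + tiltConst p a * (3 * δ * (#S).choose 2)) := by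
  have hsup : SupportedOn (fun A => IsGood t a δ L S A ∧ IsGood t a δ L T A)
      (pairs S ∪ pairs T) := fun e he A => by
    rw [notMem_union] at he
    simp only [isGood_supportedOn e he.1 A, isGood_supportedOn e he.2 A]
  rw [hsup.bprob_eq (union_subset hS hT)]
  have hcard : ∀ A ⊆ pairs S ∪ pairs T, (#A : ℝ) =
      #(A ∩ pairs S) + #(A ∩ pairs T) - #(A ∩ pairs (S ∩ T)) := fun A hA => by
    have := card_union_add_card_inter (A ∩ pairs S) (A ∩ pairs T)
    rw [← inter_union_distrib_left, inter_eq_left.2 hA, ← inter_inter_distrib_left,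
      ← pairs_inter] at this
    have h2 : (#A : ℝ) + #(A ∩ pairs (S ∩ T)) = #(A ∩ pairs S) + #(A ∩ pairs T) := by
      exact_mod_cast this
    linarith
  have hI : #(S ∩ T) ≤ #S := card_le_card inter_subset_left
  have hEc := hcard _ subset_rfl
  rw [inter_eq_right.2 subset_union_left, inter_eq_right.2 subset_union_right,
    inter_eq_right.2 ((pairs_mono inter_subset_left).trans subset_union_left), card_pairs,
    card_pairs, card_pairs, hST] at hEc
  have hmono : ((#(S ∩ T)).choose 2 : ℝ) ≤ (#S).choose 2 := by
    exact_mod_cast Nat.choose_le_choose 2 hI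
  have h := bprob_le_exp_of_tilt (E := pairs S ∪ pairs T)
    (Q := fun A => IsGood t a δ L S A ∧ IsGood t a δ L T A)
    (d := 3 * δ * (#S).choose 2) hp0 hp1 ha0 ha1 fun A hA hG => by
      have g1 := abs_le.1 (hG.1.2 S subset_rfl (hL.trans hI))
      have g2 := abs_le.1 (hG.2.2 T subset_rfl ((hL.trans hI).trans hST.ge))
      have g3 := abs_le.1 (hG.1.2 (S ∩ T) inter_subset_left hL)
      rw [card_pairs] at g1 g2 g3
      rw [hST] at g2
      have : a * (δ * (#(S ∩ T)).choose 2) ≤ a * (δ * (#S).choose 2) := by gcongr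
      rw [hcard A hA, hEc, abs_le]
      constructor <;> linarith
  rw [hEc] at h
  convert h using 3
  ring

/-- Serves for overlaps too small for the density condition to apply. -/
theorem pow_mul_bprob_and_le {c : ℝ} (hc0 : 0 ≤ c) (hcp : c ≤ p) (hcq : c ≤ 1 - p)
    {α : Type*} [DecidableEq α] {E D₁ D₂ : Finset α} {Q R : Finset α → Prop}
    (hQ : SupportedOn Q D₁) (hR : SupportedOn R D₂) (hE : D₁ ⊆ E) :
    c ^ #(D₁ ∩ D₂) * bprob E p (fun A => Q A ∧ R A) ≤ bprob E p Q * bprob E p R := by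
  classical
  have h := bexp_mul_le (f := fun A => if Q A then 1 else 0) (g := fun A => if R A then 1 else 0)
    hc0 hcp hcq (D₁ := D₁) (D₂ := D₂)
    (fun e he A => by have := hQ e he A; by_cases hA : Q A <;> simp [this, hA])
    (fun e he A => by have := hR e he A; by_cases hA : R A <;> simp [this, hA])
    (fun A => by split_ifs <;> norm_num) (fun A => by split_ifs <;> norm_num) E
  rw [inter_eq_right.2 (inter_subset_left.trans hE)] at h
  have e : bprob E p (fun A => Q A ∧ R A) =
      bexp E p (fun A => (if Q A then 1 else 0) * (if R A then 1 else 0)) :=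
    bexp_congr fun A _ => by by_cases h1 : Q A <;> by_cases h2 : R A <;> simp [h1, h2]
  rw [e, bprob, bprob]
  convert h

theorem bprob_isGood_zero (ht : 0 ≤ t) : bprob E 0 (IsGood t 0 δ L S) = 1 := by
  rw [bprob, bexp_zero, if_pos]
  exact ⟨by simpa using fun _ _ => ht, by simp⟩

/-- A union bound at density `a`: over the vertices for the degrees, where `η` is the slack below
`t`, and over at most 2^|S| subsets for the densities. The latter is affordable when |S| and `L` are
of order ln n, since the exponent is then of order (ln n)². -/
theorem bprob_not_isGood_le {η : ℝ} (ha0 : 0 < a) (ha1 : a ≤ 1) (hδ : 0 < δ) (hδ1 : δ ≤ 1)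
    (hη : 0 < η) (hη1 : η ≤ 1) (ht : a * #S + η * #S ≤ t) (hL : 2 ≤ L) :
    bprob (pairs S) a (fun A => ¬ IsGood t a δ L S A) ≤
      #S * Real.exp (-(η ^ 2 * #S / 4)) +
        2 ^ #S * (2 * Real.exp (-((a * δ) ^ 2 * L.choose 2 / 4))) := by
  have hdeg : ∀ v ∈ S, bprob (pairs S) a (fun A => t < #(A ∩ star S v)) ≤
      Real.exp (-(η ^ 2 * #S / 4)) := fun v hv => by
    have hS : 0 < #S := card_pos.2 ⟨v, hv⟩
    have hS' : (0 : ℝ) < #S := by exact_mod_cast hS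
    have hsup : SupportedOn (fun A => t < (#(A ∩ star S v) : ℝ)) (star S v) :=
      supportedOn_inter (fun B => t < (#B : ℝ)) subset_rfl
    rw [hsup.bprob_eq (star_subset_pairs hv)]
    have h := bprob_add_le_le_exp (E := star S v) (f := fun A => (#(A ∩ star S v) : ℝ)) ha0.le ha1
      (fun e A => abs_card_insert_inter_sub_le _ e A) (d := η * #S) (N := #S) (by positivity) hS'
      (by nlinarith) (by rw [card_star hv]; exact_mod_cast Nat.sub_le _ _)
    refine (bprob_mono ha0.le ha1 fun A _ hA => ?_).trans (h.trans_eq ?_)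
    · rw [bexp_card_inter subset_rfl]
      have : (#(star S v) : ℝ) ≤ #S := by rw [card_star hv]; exact_mod_cast Nat.sub_le _ _
      nlinarith
    · congr 2; field_simp
  have hden : ∀ U ∈ S.powerset.filter (L ≤ #·), bprob (pairs S) a
      (fun A => ¬ |(#(A ∩ pairs U) : ℝ) - a * #(pairs U)| ≤ a * (δ * #(pairs U))) ≤
      2 * Real.exp (-((a * δ) ^ 2 * L.choose 2 / 4)) := fun U hU => by
    rw [mem_filter, mem_powerset] at hU
    have hN : (L.choose 2 : ℝ) ≤ #(pairs U) := by
      rw [card_pairs]; exact_mod_cast Nat.choose_le_choose 2 hU.2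
    have hN0 : (0 : ℝ) < #(pairs U) := by
      have : 0 < L.choose 2 := Nat.choose_pos hL
      exact lt_of_lt_of_le (by exact_mod_cast this) hN
    have hsup : SupportedOn (fun A => ¬ |(#(A ∩ pairs U) : ℝ) - a * #(pairs U)| ≤
        a * (δ * #(pairs U))) (pairs U) :=
      supportedOn_inter (fun B => ¬ |(#B : ℝ) - a * #(pairs U)| ≤ a * (δ * #(pairs U))) subset_rfl
    rw [hsup.bprob_eq (pairs_mono hU.1)]
    have haδ : a * δ ≤ 1 := mul_le_one₀ ha1 hδ.le hδ1
    have h1 := bprob_add_le_le_exp (E := pairs U) (f := fun A => (#(A ∩ pairs U) : ℝ)) ha0.le ha1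
      (fun e A => abs_card_insert_inter_sub_le _ e A) (d := a * δ * #(pairs U)) (N := #(pairs U))
      (by positivity) hN0 (by nlinarith) le_rfl
    have h2 := bprob_le_sub_le_exp (E := pairs U) (f := fun A => (#(A ∩ pairs U) : ℝ)) ha0.le ha1
      (fun e A => abs_card_insert_inter_sub_le _ e A) (d := a * δ * #(pairs U)) (N := #(pairs U))
      (by positivity) hN0 (by nlinarith) le_rfl
    have hexp : Real.exp (-((a * δ * #(pairs U)) ^ 2 / (4 * #(pairs U)))) ≤
        Real.exp (-((a * δ) ^ 2 * L.choose 2 / 4)) := by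
      have e : (a * δ * #(pairs U)) ^ 2 / (4 * #(pairs U)) = (a * δ) ^ 2 * #(pairs U) / 4 := by
        field_simp
      rw [e]
      gcongr
    rw [bexp_card_inter subset_rfl] at h1 h2
    calc _ ≤ _ := bprob_mono (R := fun A => a * #(pairs U) + a * δ * #(pairs U) ≤ #(A ∩ pairs U) ∨
          #(A ∩ pairs U) ≤ a * #(pairs U) - a * δ * #(pairs U)) ha0.le ha1 fun A _ hA => by
            by_contra! hcon
            refine hA (abs_le.2 ⟨?_, ?_⟩) <;> linarith [hcon.1, hcon.2]
      _ ≤ _ := bprob_or_le ha0.le ha1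
      _ ≤ _ := by linarith
  calc bprob (pairs S) a (fun A => ¬ IsGood t a δ L S A)
      ≤ bprob (pairs S) a (fun A => (∃ v ∈ S, t < (#(A ∩ star S v) : ℝ)) ∨
          ∃ U ∈ S.powerset.filter (L ≤ #·),
            ¬ |(#(A ∩ pairs U) : ℝ) - a * #(pairs U)| ≤ a * (δ * #(pairs U))) := by
        refine bprob_mono ha0.le ha1 fun A _ hA => ?_
        by_contra! hcon
        exact hA ⟨hcon.1, fun U hU hLU => hcon.2 U (by simp [hU, hLU])⟩
    _ ≤ _ := bprob_or_le ha0.le ha1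
    _ ≤ (∑ v ∈ S, Real.exp (-(η ^ 2 * #S / 4))) +
          ∑ U ∈ S.powerset.filter (L ≤ #·), 2 * Real.exp (-((a * δ) ^ 2 * L.choose 2 / 4)) :=
        add_le_add ((bprob_exists_le ha0.le ha1 _ _).trans (sum_le_sum hdeg))
          ((bprob_exists_le ha0.le ha1 _ _).trans (sum_le_sum hden))
    _ ≤ _ := by
        rw [sum_const, sum_const, nsmul_eq_mul, nsmul_eq_mul]
        have : (#(S.powerset.filter (L ≤ #·)) : ℝ) ≤ 2 ^ #S := by
          have := card_filter_le S.powerset (L ≤ #·)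
          rw [card_powerset] at this
          exact_mod_cast this
        gcongr

end Pairs

/-! ### Conflict-free subfamilies by sampling and deletion. -/

section Independent

variable {ι : Type*} [DecidableEq ι] (c : ι → ι → Prop) [DecidableRel c]

/-- Delete one member of a conflicting pair; each deletion destroys at least one conflict. -/
theorem exists_independent_subset (P : Finset ι) :
    ∃ P' ⊆ P, (∀ i ∈ P', ∀ j ∈ P', i ≠ j → ¬ c i j) ∧
      #P ≤ #P' + #(P.offDiag.filter fun x => c x.1 x.2) := by
  induction P using Finset.strongInduction with
  | H P ih =>
    by_cases h : ∀ i ∈ P, ∀ j ∈ P, i ≠ j → ¬ c i j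
    · exact ⟨P, subset_rfl, h, Nat.le_add_right _ _⟩
    · push Not at h
      obtain ⟨i, hi, j, hj, hij, hc⟩ := h
      obtain ⟨P', hP', hind, hcard⟩ := ih _ (erase_ssubset hi)
      refine ⟨P', hP'.trans (erase_subset _ _), hind, ?_⟩
      have hlt : #((P.erase i).offDiag.filter fun x => c x.1 x.2)
          < #(P.offDiag.filter fun x => c x.1 x.2) := by
        refine card_lt_card (Finset.ssubset_iff_subset_ne.2
          ⟨filter_subset_filter _ (offDiag_mono (erase_subset _ _)), fun heq => ?_⟩)
        have : (i, j) ∈ P.offDiag.filter fun x => c x.1 x.2 := by simp [hi, hj, hij, hc]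
        rw [← heq] at this
        simp at this
      have := card_erase_add_one hi
      omega

/-- Keep each element with probability `θ`: an element survives with probability θ and a conflict
with probability θ². Some outcome is at least as good as the mean, and deletion removes its
conflicts. -/
theorem exists_independent_ge (G : Finset ι) {θ : ℝ} (h0 : 0 ≤ θ) (h1 : θ ≤ 1) :
    ∃ P ⊆ G, (∀ i ∈ P, ∀ j ∈ P, i ≠ j → ¬ c i j) ∧
      θ * #G - θ ^ 2 * #(G.offDiag.filter fun x => c x.1 x.2) ≤ #P := by
  set C := G.offDiag.filter fun x => c x.1 x.2 with hC
  obtain ⟨A, hA, hle⟩ := exists_bexp_le h0 h1 G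
    fun A => (#(A ∩ G) : ℝ) - ∑ x ∈ C, if x.1 ∈ A ∧ x.2 ∈ A then 1 else 0
  obtain ⟨P, hPA, hind, hcard⟩ := exists_independent_subset c A
  refine ⟨P, hPA.trans hA, hind, ?_⟩
  have hsum : ∑ x ∈ C, bexp G θ (fun A => if x.1 ∈ A ∧ x.2 ∈ A then 1 else 0) = #C * θ ^ 2 := by
    rw [← nsmul_eq_mul, ← sum_const]
    refine sum_congr rfl fun x hx => ?_
    rw [hC, mem_filter, mem_offDiag] at hx
    exact bexp_indicator_mem_and_mem hx.1.2.2 hx.1.1 hx.1.2.1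
  rw [bexp_sub, bexp_card_inter subset_rfl, bexp_sum, hsum, mul_comm (#C : ℝ)] at hle
  refine hle.trans ?_
  have e : C.filter (fun x => x.1 ∈ A ∧ x.2 ∈ A) = A.offDiag.filter fun x => c x.1 x.2 := by
    ext x
    simp only [hC, mem_filter, mem_offDiag]
    constructor
    · rintro ⟨⟨⟨_, _, h3⟩, h4⟩, h5, h6⟩; exact ⟨⟨h5, h6, h3⟩, h4⟩
    · rintro ⟨⟨h5, h6, h3⟩, h4⟩; exact ⟨⟨⟨hA h5, hA h6, h3⟩, h4⟩, h5, h6⟩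
  rw [inter_eq_left.2 hA, sum_boole, e]
  have : (#A : ℝ) ≤ #P + #(A.offDiag.filter fun x => c x.1 x.2) := by exact_mod_cast hcard
  linarith

end Independent

/-! ### The packing number and its concentration. -/

section Packing

variable {V : Type*} [DecidableEq V]

open Classical in
/-- The largest number of good sets in a subfamily of `F` whose members pairwise share at most one
vertex. -/
noncomputable def packingNumber (F : Finset (Finset V))
    (Good : Finset V → Finset (Sym2 V) → Prop) (A : Finset (Sym2 V)) : ℕ :=
  (F.powerset.filter fun P => ∀ S ∈ P, ∀ T ∈ P, S ≠ T → ¬ 2 ≤ #(S ∩ T)).sup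
    fun P => #(P.filter fun S => Good S A)

variable {F : Finset (Finset V)} {Good : Finset V → Finset (Sym2 V) → Prop}

/-- Members sharing at most one vertex have no common pair, so at most one member of the subfamily
contains `e`; only that one can change its status. -/
theorem packingNumber_le_of_eq_off {e : Sym2 V}
    {A B : Finset (Sym2 V)} (hAB : ∀ S, e ∉ pairs S → (Good S A ↔ Good S B)) :
    packingNumber F Good A ≤ packingNumber F Good B + 1 := by
  classical
  refine Finset.sup_le fun P hP => ?_
  have hind := (mem_filter.1 hP).2
  have h1 : #(P.filter fun S => e ∈ pairs S) ≤ 1 := by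
    refine card_le_one.2 fun S hS T hT => ?_
    rw [mem_filter] at hS hT
    by_contra hne
    refine hind S hS.1 T hT.1 hne ?_
    have hmem : e ∈ pairs (S ∩ T) := by rw [pairs_inter]; exact mem_inter.2 ⟨hS.2, hT.2⟩
    have := card_pos.2 ⟨e, hmem⟩
    rw [card_pairs] at this
    by_contra! hlt
    rw [Nat.choose_eq_zero_of_lt hlt] at this
    exact this.false
  calc #(P.filter fun S => Good S A)
      ≤ #((P.filter fun S => Good S B) ∪ P.filter fun S => e ∈ pairs S) := by
        refine card_le_card fun S hS => ?_
        rw [mem_filter] at hS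
        by_cases h : e ∈ pairs S
        · simp [hS.1, h]
        · simp [hS.1, h, ← hAB S h, hS.2]
    _ ≤ #(P.filter fun S => Good S B) + 1 := (card_union_le _ _).trans (by omega)
    _ ≤ packingNumber F Good B + 1 := by
        gcongr
        exact Finset.le_sup (f := fun P => #(P.filter fun S => Good S B)) hP

theorem abs_packingNumber_insert_sub_le (hG : ∀ S, SupportedOn (Good S) (pairs S)) (e : Sym2 V)
    (A : Finset (Sym2 V)) :
    |(packingNumber F Good (insert e A) : ℝ) - packingNumber F Good A| ≤ 1 := by
  have h : ∀ S, e ∉ pairs S → (Good S (insert e A) ↔ Good S A) := fun S he =>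
    iff_of_eq (hG S e he A)
  have h1 := packingNumber_le_of_eq_off (F := F) h
  have h2 := packingNumber_le_of_eq_off (F := F) fun S he => (h S he).symm
  have h1' : (packingNumber F Good (insert e A) : ℝ) ≤ packingNumber F Good A + 1 := by
    exact_mod_cast h1
  have h2' : (packingNumber F Good A : ℝ) ≤ packingNumber F Good (insert e A) + 1 := by
    exact_mod_cast h2
  rw [abs_le]
  constructor <;> linarith

open Classical in
theorem le_packingNumber {θ : ℝ} (h0 : 0 ≤ θ) (h1 : θ ≤ 1) (A : Finset (Sym2 V)) :
    θ * (∑ S ∈ F, if Good S A then 1 else 0) -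
      θ ^ 2 * (∑ x ∈ F.offDiag.filter (fun x => 2 ≤ #(x.1 ∩ x.2)),
        if Good x.1 A ∧ Good x.2 A then 1 else 0) ≤ packingNumber F Good A := by
  obtain ⟨P, hP, hind, hle⟩ := exists_independent_ge (fun S T : Finset V => 2 ≤ #(S ∩ T))
    (F.filter fun S => Good S A) h0 h1
  have hPF : P ∈ F.powerset.filter fun P => ∀ S ∈ P, ∀ T ∈ P, S ≠ T → ¬ 2 ≤ #(S ∩ T) :=
    mem_filter.2 ⟨mem_powerset.2 (hP.trans (filter_subset _ _)), hind⟩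
  have h2 : #P ≤ packingNumber F Good A := by
    have := Finset.le_sup (f := fun P => #(P.filter fun S => Good S A)) hPF
    refine le_trans (card_le_card fun S hS => ?_) this
    exact mem_filter.2 ⟨hS, (mem_filter.1 (hP hS)).2⟩
  have e : (F.filter fun S => Good S A).offDiag.filter (fun x => 2 ≤ #(x.1 ∩ x.2)) =
      (F.offDiag.filter (fun x => 2 ≤ #(x.1 ∩ x.2))).filter
        fun x => Good x.1 A ∧ Good x.2 A := by
    ext x
    simp only [mem_filter, mem_offDiag]
    tauto
  rw [sum_boole, sum_boole, ← e]
  exact hle.trans (by exact_mod_cast h2)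

/-- If no set is good, the packing number is 0, which is at least 1/(4r) below its mean; bounded
differences make this unlikely. -/
theorem bprob_forall_not_good_le (hG : ∀ S, SupportedOn (Good S) (pairs S))
    (hF : ∀ S ∈ F, 2 ≤ #S) {E : Finset (Sym2 V)} {p r N : ℝ} (hp0 : 0 ≤ p) (hp1 : p ≤ 1)
    (hr : 0 < r) (hN : 0 < N) (hrN : 1 / (4 * r) ≤ 2 * N) (hE : (#E : ℝ) ≤ N)
    (hμ : 0 < ∑ S ∈ F, bprob E p (Good S))
    (hpair : ∑ S ∈ F, ∑ T ∈ F.filter (fun T => 2 ≤ #(S ∩ T)),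
      bprob E p (fun A => Good S A ∧ Good T A) ≤ r * (∑ S ∈ F, bprob E p (Good S)) ^ 2) :
    bprob E p (fun A => ∀ S ∈ F, ¬ Good S A) ≤ Real.exp (-((1 / (4 * r)) ^ 2 / (4 * N))) := by
  classical
  set μ := ∑ S ∈ F, bprob E p (Good S) with hμdef
  set D := ∑ x ∈ F.offDiag.filter (fun x => 2 ≤ #(x.1 ∩ x.2)),
    bprob E p (fun A => Good x.1 A ∧ Good x.2 A) with hD
  have hnn : ∀ S T, 0 ≤ bprob E p (fun A => Good S A ∧ Good T A) := fun S T =>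
    bprob_nonneg hp0 hp1
  have hsum : ∑ S ∈ F, ∑ T ∈ F.filter (fun T => 2 ≤ #(S ∩ T)),
      bprob E p (fun A => Good S A ∧ Good T A) =
      ∑ x ∈ (F ×ˢ F).filter (fun x => 2 ≤ #(x.1 ∩ x.2)),
        bprob E p (fun A => Good x.1 A ∧ Good x.2 A) := by
    rw [sum_filter, sum_product]
    exact sum_congr rfl fun S _ => sum_filter _ _
  rw [hsum] at hpair
  have hDle : D ≤ r * μ ^ 2 := by
    refine (sum_le_sum_of_subset_of_nonneg ?_ fun x _ _ => hnn _ _).trans hpair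
    exact filter_subset_filter _ fun x hx => by
      rw [mem_offDiag] at hx; exact mem_product.2 ⟨hx.1, hx.2.1⟩
  -- The diagonal terms S = T belong to the sum in `hpair`, because members of `F` have at least two
  -- vertices. This forces rμ ≥ 1 and makes the sampling rate below admissible.
  have hμle : μ ≤ r * μ ^ 2 := by
    refine le_trans ?_ hpair
    have : μ = ∑ x ∈ F.image fun S => (S, S), bprob E p (fun A => Good x.1 A ∧ Good x.2 A) := by
      rw [sum_image fun S _ T _ h => (Prod.mk.inj h).1]
      simp [hμdef]
    rw [this]
    refine sum_le_sum_of_subset_of_nonneg (fun x hx => ?_) fun x _ _ => hnn _ _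
    obtain ⟨S, hS, rfl⟩ := mem_image.1 hx
    simp [hS, hF S hS]
  have hrμ : 1 ≤ r * μ := by
    by_contra! h
    nlinarith
  -- Maximises θμ - θ²rμ², with maximum 1/(4r).
  set θ := 1 / (2 * (r * μ)) with hθ
  have hθ0 : 0 ≤ θ := by positivity
  have hθ1 : θ ≤ 1 := by rw [hθ, div_le_one (by positivity)]; linarith
  set Y : Finset (Sym2 V) → ℝ := fun A => packingNumber F Good A with hY
  have hEY : 1 / (4 * r) ≤ bexp E p Y := by
    have h := bexp_mono (E := E) hp0 hp1 fun A _ =>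
      le_packingNumber (F := F) (Good := Good) hθ0 hθ1 A
    rw [bexp_sub, bexp_mul_left, bexp_mul_left, bexp_sum, bexp_sum] at h
    have h' : θ * μ - θ ^ 2 * D ≤ bexp E p Y := by
      rw [hμdef, hD]
      unfold bprob
      convert h
    refine le_trans ?_ h'
    have h2 : θ * μ = 1 / (2 * r) := by rw [hθ]; field_simp
    have h3 : θ ^ 2 * D ≤ θ ^ 2 * (r * μ ^ 2) := by gcongr
    have h4 : θ ^ 2 * (r * μ ^ 2) = 1 / (4 * r) := by rw [hθ]; field_simp; norm_num
    have h5 : 1 / (2 * r) = 1 / (4 * r) + 1 / (4 * r) := by field_simp; norm_num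
    linarith
  refine (bprob_mono hp0 hp1 fun A _ hA => ?_).trans
    (bprob_le_sub_le_exp (f := Y) hp0 hp1 (abs_packingNumber_insert_sub_le hG)
      (d := 1 / (4 * r)) (by positivity) hN hrN hE)
  have : packingNumber F Good A = 0 := by
    refine Nat.le_zero.1 (Finset.sup_le fun P hP => ?_)
    rw [mem_filter, mem_powerset] at hP
    rw [filter_eq_empty_iff.2 fun S hS => hA S (hP.1 hS), card_empty]
  simp only [hY, this]
  push_cast
  linarith

end Packing

/-! ### Invariance under permutations of the vertices. -/

section Symmetry

theorem bexp_image {α β : Type*} [DecidableEq α] [DecidableEq β] {g : α → β}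
    (hg : Function.Injective g) (E : Finset α) (p : ℝ) (f : Finset β → ℝ) :
    bexp (E.image g) p f = bexp E p fun A => f (A.image g) := by
  induction E using Finset.induction generalizing f with
  | empty => simp [bexp_empty]
  | insert a E ha ih =>
    rw [image_insert, bexp_insert ha, bexp_insert (by simpa [hg.eq_iff] using ha), ih, ih]
    simp only [image_insert]

variable {V : Type*} [DecidableEq V]

theorem pairs_image {g : V → V} (hg : Function.Injective g) (S : Finset V) :
    pairs (S.image g) = (pairs S).image (Sym2.map g) := by
  ext e
  induction e with | _ x y
  simp only [mk_mem_pairs, mem_image]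
  constructor
  · rintro ⟨⟨⟨v, hv, rfl⟩, w, hw, rfl⟩, hne⟩
    exact ⟨s(v, w), mk_mem_pairs.2 ⟨⟨hv, hw⟩, fun h => hne (by rw [h])⟩, rfl⟩
  · rintro ⟨e, he, heq⟩
    induction e with | _ v w
    rw [mk_mem_pairs] at he
    rw [Sym2.map_mk, Sym2.eq_iff] at heq
    have hne : g v ≠ g w := fun h => he.2 (hg h)
    rcases heq with ⟨rfl, rfl⟩ | ⟨rfl, rfl⟩
    · exact ⟨⟨⟨v, he.1.1, rfl⟩, w, he.1.2, rfl⟩, hne⟩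
    · exact ⟨⟨⟨w, he.1.2, rfl⟩, v, he.1.1, rfl⟩, hne.symm⟩

theorem star_image {g : V → V} (hg : Function.Injective g) (S : Finset V) (v : V) :
    star (S.image g) (g v) = (star S v).image (Sym2.map g) := by
  rw [star, star, ← image_erase hg, image_image, image_image]
  rfl

variable {t a δ : ℝ} {L : ℕ}

theorem IsGood.image {g : V → V} (hg : Function.Injective g) {S : Finset V}
    {A : Finset (Sym2 V)} (h : IsGood t a δ L S A) :
    IsGood t a δ L (S.image g) (A.image (Sym2.map g)) := by
  have hg2 := Sym2.map.injective hg
  constructor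
  · intro v hv
    obtain ⟨v, hv', rfl⟩ := mem_image.1 hv
    rw [star_image hg, ← image_inter _ _ hg2, card_image_of_injective _ hg2]
    exact h.1 v hv'
  · intro U hU hL
    obtain ⟨U, hU', rfl⟩ := subset_image_iff.1 hU
    rw [card_image_of_injective _ hg] at hL
    rw [pairs_image hg, ← image_inter _ _ hg2, card_image_of_injective _ hg2,
      card_image_of_injective _ hg2]
    exact h.2 U (by exact_mod_cast hU') hL

theorem exists_perm_image_eq [Fintype V] {S T : Finset V} (h : #S = #T) :
    ∃ σ : Equiv.Perm V, S.image σ = T := by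
  let e : {x // x ∈ S} ≃ {x // x ∈ T} := Finset.equivOfCardEq h
  refine ⟨e.extendSubtype, eq_of_subset_of_card_le (fun x hx => ?_) ?_⟩
  · obtain ⟨y, hy, rfl⟩ := mem_image.1 hx
    exact e.extendSubtype_mem y hy
  · rw [card_image_of_injective _ (Equiv.injective _), h]

/-- A permutation carries one set to the other and preserves the product measure. The common value
turns the pair sum into a multiple of the squared mean. -/
theorem bprob_isGood_eq_of_card_eq [Fintype V] {p : ℝ} (hp0 : 0 ≤ p) (hp1 : p ≤ 1)
    {E : Finset (Sym2 V)} {S T : Finset V} (hS : pairs S ⊆ E) (hT : pairs T ⊆ E)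
    (h : #S = #T) : bprob E p (IsGood t a δ L S) = bprob E p (IsGood t a δ L T) := by
  suffices key : ∀ S T : Finset V, #S = #T →
      bprob (pairs S) p (IsGood t a δ L S) ≤ bprob (pairs T) p (IsGood t a δ L T) by
    rw [isGood_supportedOn.bprob_eq hS, isGood_supportedOn.bprob_eq hT]
    exact le_antisymm (key S T h) (key T S h.symm)
  intro S T h
  obtain ⟨σ, rfl⟩ := exists_perm_image_eq h
  have h2 : bprob (pairs (S.image σ)) p (IsGood t a δ L (S.image σ)) = bprob (pairs S) p
      fun A => IsGood t a δ L (S.image σ) (A.image (Sym2.map σ)) := by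
    rw [bprob, pairs_image σ.injective, bexp_image (Sym2.map.injective σ.injective)]
    rfl
  rw [h2]
  exact bprob_mono hp0 hp1 fun A _ hA => hA.image σ.injective

end Symmetry

/-! ### Counting sets by their intersection with a fixed set. -/

section Counting

/-- The quotient of the binomials is the product of (k-i)/(m-i) over i < l, and each factor is at
most k/m. -/
theorem choose_sub_mul_pow_le {m k : ℕ} (hkm : k ≤ m) {l : ℕ} (hl : l ≤ k) :
    (m - l).choose (k - l) * m ^ l ≤ m.choose k * k ^ l := by
  induction l with
  | zero => simp
  | succ l ih =>
    have ih := ih (by omega)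
    obtain ⟨m', hm'⟩ : ∃ m', m - l = m' + 1 := ⟨m - l - 1, by omega⟩
    obtain ⟨k', hk'⟩ : ∃ k', k - l = k' + 1 := ⟨k - l - 1, by omega⟩
    have h1 : m - (l + 1) = m' := by omega
    have h2 : k - (l + 1) = k' := by omega
    rw [h1, h2]
    rw [hm', hk'] at ih
    have h3 := Nat.add_one_mul_choose_eq m' k'
    have h4 : (k' + 1) * m ≤ k * (m' + 1) := by
      have : m = m' + 1 + l := by omega
      have hk : k = k' + 1 + l := by omega
      have : k' ≤ m' := by omega
      subst hk
      rw [‹m = _›]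
      nlinarith
    refine Nat.le_of_mul_le_mul_left (c := m' + 1) ?_ (by omega)
    calc (m' + 1) * (m'.choose k' * m ^ (l + 1))
        = ((m' + 1) * m'.choose k') * m ^ l * m := by ring
      _ = ((m' + 1).choose (k' + 1) * m ^ l) * ((k' + 1) * m) := by rw [h3]; ring
      _ ≤ (m.choose k * k ^ l) * (k * (m' + 1)) := Nat.mul_le_mul ih h4
      _ = (m' + 1) * (m.choose k * k ^ (l + 1)) := by ring

variable {V : Type*} [DecidableEq V]

theorem card_filter_subset_le {W I : Finset V} {k : ℕ} (hIk : #I ≤ k) (hkW : k ≤ #W)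
    (hI : I ⊆ W) :
    (#((W.powersetCard k).filter fun T => I ⊆ T) : ℝ) ≤
      (#W).choose k * ((k : ℝ) / #W) ^ #I := by
  rcases Nat.eq_zero_or_pos #W with hW | hW
  · have : #I = 0 := by omega
    have h0 : k = 0 := by omega
    simp only [this, pow_zero, mul_one]
    have := card_filter_le (W.powersetCard k) fun T => I ⊆ T
    rw [card_powersetCard] at this
    exact_mod_cast this
  have h1 : #((W.powersetCard k).filter fun T => I ⊆ T) ≤ (#W - #I).choose (k - #I) := by
    rw [← card_sdiff_of_subset hI, ← card_powersetCard]
    refine card_le_card_of_injOn (fun T => T \ I) (fun T hT => ?_) fun T hT T' hT' h => ?_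
    · simp only [coe_filter, mem_powersetCard, Set.mem_ofPred_eq] at hT
      rw [mem_coe, mem_powersetCard]
      exact ⟨sdiff_subset_sdiff hT.1.1 subset_rfl, by rw [card_sdiff_of_subset hT.2, hT.1.2]⟩
    · simp only [coe_filter, Set.mem_ofPred_eq] at hT hT'
      rw [← sdiff_union_of_subset hT.2, ← sdiff_union_of_subset hT'.2]
      simp only at h
      rw [h]
  have h2 := choose_sub_mul_pow_le hkW hIk
  have hW' : (0 : ℝ) < (#W : ℝ) ^ #I := by positivity
  rw [div_pow, ← mul_div_assoc, le_div_iff₀ hW']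
  exact_mod_cast (Nat.mul_le_mul_right _ h1).trans h2

/-- Group the sets T by I = S ∩ T. There are at most k^l choices of I of size l, and a fraction of
at most (k/|W|)^l of all T contains a given I; at most k values of l occur. -/
theorem sum_card_inter_le {W S : Finset V} {k : ℕ} (hS : S ⊆ W) (hk : #S = k) (hk2 : 2 ≤ k)
    {R : ℕ → ℝ} (hR : ∀ l, 0 ≤ R l) {ρ : ℝ}
    (hρ : ∀ l, 2 ≤ l → l ≤ k → ((k : ℝ) ^ 2 / #W) ^ l * R l ≤ ρ) :
    ∑ T ∈ (W.powersetCard k).filter (fun T => 2 ≤ #(S ∩ T)), R #(S ∩ T) ≤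
      (#W).choose k * (k * ρ) := by
  have hkW : k ≤ #W := hk ▸ card_le_card hS
  set c : ℝ := ((#W).choose k : ℝ) with hc
  have hc0 : 0 ≤ c := by positivity
  calc ∑ T ∈ (W.powersetCard k).filter (fun T => 2 ≤ #(S ∩ T)), R #(S ∩ T)
      = ∑ T ∈ W.powersetCard k, if 2 ≤ #(S ∩ T) then R #(S ∩ T) else 0 := sum_filter _ _
    _ = ∑ I ∈ S.powerset, ∑ T ∈ (W.powersetCard k).filter (fun T => S ∩ T = I),
          if 2 ≤ #(S ∩ T) then R #(S ∩ T) else 0 :=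
        (sum_fiberwise_of_maps_to (fun T _ => mem_powerset.2 inter_subset_left) _).symm
    _ ≤ ∑ I ∈ S.powerset, if 2 ≤ #I then c * ((k : ℝ) / #W) ^ #I * R #I else 0 := by
        refine sum_le_sum fun I hI => ?_
        rw [mem_powerset] at hI
        rw [sum_congr rfl fun T hT => by rw [(mem_filter.1 hT).2], sum_const, nsmul_eq_mul]
        split_ifs with h
        · refine mul_le_mul_of_nonneg_right ?_ (hR _)
          refine le_trans ?_ (card_filter_subset_le (hk ▸ card_le_card hI) hkW (hI.trans hS))
          have : #((W.powersetCard k).filter fun T => S ∩ T = I) ≤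
              #((W.powersetCard k).filter fun T => I ⊆ T) :=
            card_le_card (monotone_filter_right _ fun T _ hT => hT ▸ inter_subset_right)
          exact_mod_cast this
        · simp
    _ = ∑ l ∈ range (k + 1), (k.choose l : ℝ) *
          if 2 ≤ l then c * ((k : ℝ) / #W) ^ l * R l else 0 := by
        rw [sum_powerset_apply_card (fun l => if 2 ≤ l then c * ((k : ℝ) / #W) ^ l * R l else 0),
          hk]
        simp only [nsmul_eq_mul]
    _ = ∑ l ∈ (range (k + 1)).filter (2 ≤ ·), (k.choose l : ℝ) *
          (c * ((k : ℝ) / #W) ^ l * R l) := by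
        rw [sum_filter]
        simp only [mul_ite, mul_zero]
    _ ≤ ∑ l ∈ (range (k + 1)).filter (2 ≤ ·), c * ρ := by
        refine sum_le_sum fun l hl => ?_
        rw [mem_filter, mem_range] at hl
        have h1 : (k.choose l : ℝ) ≤ (k : ℝ) ^ l := by exact_mod_cast Nat.choose_le_pow k l
        have hRl := hR l
        calc (k.choose l : ℝ) * (c * ((k : ℝ) / #W) ^ l * R l)
            ≤ (k : ℝ) ^ l * (c * ((k : ℝ) / #W) ^ l * R l) := by gcongr
          _ = c * (((k : ℝ) ^ 2 / #W) ^ l * R l) := by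
              rw [div_pow, div_pow, ← pow_mul, mul_comm 2 l, pow_mul]; ring
          _ ≤ c * ρ := by gcongr; exact hρ l hl.2 (by omega)
    _ ≤ k * (c * ρ) := by
        rw [sum_const, nsmul_eq_mul]
        have hρ0 : 0 ≤ ρ :=
          le_trans (mul_nonneg (by positivity) (hR 2)) (hρ 2 le_rfl hk2)
        have : #((range (k + 1)).filter (2 ≤ ·)) ≤ k := by
          have : (range (k + 1)).filter (2 ≤ ·) ⊆ (range (k + 1)).erase 0 := fun l hl => by
            rw [mem_filter] at hl
            exact mem_erase.2 ⟨by omega, hl.1⟩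
          refine (card_le_card this).trans ?_
          rw [card_erase_of_mem (by simp), card_range]
          simp
        gcongr
    _ = c * (k * ρ) := by ring

end Counting

/-! ### Pairs of overlapping good sets. -/

section SecondMoment

variable {V : Type*} [DecidableEq V] [Fintype V]

/-- A bound for the correlation of two good sets of size `k` that share `l` vertices. -/
noncomputable def overlapBound (p a δ : ℝ) (L k l : ℕ) : ℝ :=
  if l < L then ((min p (1 - p)) ^ l.choose 2)⁻¹
  else 4 * Real.exp (l.choose 2 * rate p a + 5 * tiltConst p a * δ * k.choose 2)

theorem overlapBound_nonneg {p : ℝ} (hp0 : 0 ≤ p) (hp1 : p ≤ 1) (a δ : ℝ) (L k l : ℕ) :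
    0 ≤ overlapBound p a δ L k l := by
  have : 0 ≤ min p (1 - p) := le_min hp0 (by linarith)
  unfold overlapBound
  split_ifs <;> positivity

theorem bprob_forall_not_isGood_le {p a δ t : ℝ} {L k : ℕ} (hp0 : 0 < p) (hp1 : p < 1)
    (ha0 : 0 ≤ a) (ha1 : a < 1) (hδ : 0 ≤ δ) (hk : 2 ≤ k) (hLk : L ≤ k) {W : Finset V}
    (hkW : k ≤ #W) {E : Finset (Sym2 V)} (hE : pairs W ⊆ E) {N : ℝ} (hN : 0 < N)
    (hEN : (#E : ℝ) ≤ N)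
    (hgood : ∀ S : Finset V, #S = k → 1 / 2 ≤ bprob (pairs S) a (IsGood t a δ L S))
    {ρ : ℝ} (hρ0 : 0 < ρ)
    (hρ : ∀ l, 2 ≤ l → l ≤ k → ((k : ℝ) ^ 2 / #W) ^ l * overlapBound p a δ L k l ≤ ρ)
    (hρN : 1 / (4 * (k * ρ)) ≤ 2 * N) :
    bprob E p (fun A => ∀ S ∈ W.powersetCard k, ¬ IsGood t a δ L S A) ≤
      Real.exp (-((1 / (4 * (k * ρ))) ^ 2 / (4 * N))) := by
  have hWE : ∀ S ∈ W.powersetCard k, pairs S ⊆ E := fun S hS =>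
    (pairs_mono (mem_powersetCard.1 hS).1).trans hE
  obtain ⟨S₀, hS₀⟩ : (W.powersetCard k).Nonempty := powersetCard_nonempty.2 hkW
  set b := bprob E p (IsGood t a δ L S₀) with hb
  have hbS : ∀ S ∈ W.powersetCard k, bprob E p (IsGood t a δ L S) = b := fun S hS =>
    bprob_isGood_eq_of_card_eq hp0.le hp1.le (hWE S hS) (hWE _ hS₀)
      ((mem_powersetCard.1 hS).2.trans (mem_powersetCard.1 hS₀).2.symm)
  set x := Real.exp (-(k.choose 2 * (rate p a + tiltConst p a * δ))) with hx
  -- This lower bound turns the joint probability for large overlaps into a multiple of b²; its 1/2,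
  -- squared, is the 4 in `overlapBound`.
  have hxb : x / 2 ≤ b := by
    have hc := (mem_powersetCard.1 hS₀).2
    have h := exp_mul_bprob_isGood_le (t := t) (δ := δ) hp0 hp1 ha0 ha1 (hc ▸ hLk) (hWE _ hS₀)
    rw [hc, ← hx, ← hb] at h
    have := mul_le_mul_of_nonneg_left (hgood S₀ hc) (Real.exp_pos
      (-(k.choose 2 * (rate p a + tiltConst p a * δ)))).le
    rw [← hx] at this
    linarith
  have hx0 : 0 < x := Real.exp_pos _
  have hb0 : 0 < b := by linarith
  have hsum : ∑ S ∈ W.powersetCard k, bprob E p (IsGood t a δ L S) = (#W).choose k * b := by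
    rw [sum_congr rfl hbS, sum_const, card_powersetCard, nsmul_eq_mul]
  have hc0 : (0 : ℝ) < (#W).choose k := by exact_mod_cast Nat.choose_pos hkW
  have hpair : ∀ S ∈ W.powersetCard k, ∀ T ∈ W.powersetCard k,
      bprob E p (fun A => IsGood t a δ L S A ∧ IsGood t a δ L T A) ≤
        overlapBound p a δ L k #(S ∩ T) * b ^ 2 := fun S hS T hT => by
    have hSk := (mem_powersetCard.1 hS).2
    have hTk := (mem_powersetCard.1 hT).2
    unfold overlapBound
    split_ifs with h
    · have hmin : 0 < min p (1 - p) := lt_min hp0 (by linarith)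
      have := pow_mul_bprob_and_le (E := E) hmin.le (min_le_left _ _) (min_le_right _ _)
        (isGood_supportedOn (t := t) (a := a) (δ := δ) (L := L) (S := S))
        (isGood_supportedOn (t := t) (a := a) (δ := δ) (L := L) (S := T)) (hWE S hS)
      rw [← pairs_inter, card_pairs, hbS S hS, hbS T hT] at this
      rw [inv_mul_eq_div, le_div_iff₀ (by positivity)]
      linarith
    · push Not at h
      refine (bprob_isGood_and_isGood_le hp0 hp1 ha0 ha1 hδ (hTk.trans hSk.symm) h (hWE S hS)
        (hWE T hT)).trans ?_
      have hb2 : (x / 2) ^ 2 ≤ b ^ 2 := by gcongr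
      calc _ = 4 * Real.exp ((#(S ∩ T)).choose 2 * rate p a
              + 5 * tiltConst p a * δ * k.choose 2) * (x / 2) ^ 2 := by
            have e : ∀ y : ℝ, 4 * y * (x / 2) ^ 2 = y * (x * x) := fun y => by ring
            rw [e, hx, ← Real.exp_add, ← Real.exp_add, hSk]
            congr 1
            ring
        _ ≤ _ := by gcongr
  have hr : 0 < k * ρ := by positivity
  refine bprob_forall_not_good_le (F := W.powersetCard k) (Good := IsGood t a δ L) (r := k * ρ)
    (fun S => isGood_supportedOn) (fun S hS => (mem_powersetCard.1 hS).2.symm ▸ hk) hp0.le hp1.le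
    hr hN hρN hEN (by rw [hsum]; positivity) ?_
  rw [hsum]
  calc _ ≤ ∑ S ∈ W.powersetCard k, (#W).choose k * (k * ρ) * b ^ 2 := by
        refine sum_le_sum fun S hS => ?_
        refine (sum_le_sum fun T hT => hpair S hS T (mem_filter.1 hT).1).trans ?_
        rw [← sum_mul]
        gcongr
        exact sum_card_inter_le (mem_powersetCard.1 hS).1 (mem_powersetCard.1 hS).2 hk
          (overlapBound_nonneg hp0.le hp1.le a δ L k) hρ
    _ = k * ρ * ((#W).choose k * b) ^ 2 := by
        rw [sum_const, card_powersetCard, nsmul_eq_mul]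
        ring

end SecondMoment

/-! ### Numerical estimates on the scale x = ln n. -/

section Asymptotics

theorem choose_two_le (l : ℕ) : (l.choose 2 : ℝ) ≤ l * l / 2 := by
  rw [Nat.cast_choose_two]
  have : (0 : ℝ) ≤ l := Nat.cast_nonneg l
  nlinarith

theorem le_choose_two {l : ℕ} (hl : 2 ≤ l) : (l : ℝ) ^ 2 / 4 ≤ l.choose 2 := by
  rw [Nat.cast_choose_two]
  have : (2 : ℝ) ≤ l := by exact_mod_cast hl
  nlinarith

/-- Each shared vertex gains a factor of about 1/n. For l ≤ cx the correlation costs at most n^(ηl).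
For larger l, the inequality l ≤ κx bounds C(l,2)·`rate p a` by g·xl, and g < 1 leaves a gain of
order exp(-const·x²). -/
theorem pow_mul_overlapBound_le {p a δ κ c η g x w : ℝ} {k L : ℕ} (hp0 : 0 < p) (hp1 : p < 1)
    (ha0 : 0 ≤ a) (hδ : 0 ≤ δ) (hx : 0 < x) (hκ : 0 < κ) (hk : (k : ℝ) ≤ κ * x)
    (hw0 : 0 < w) (hw : Real.exp x ≤ w * x ^ 2) (hL : L = ⌈c * x⌉₊)
    (hg : κ / 2 * rate p a ≤ g) (hg0 : 0 ≤ g) (hη : η ≤ 1 / 40) (hηg : η ≤ (1 - g) / 4)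
    (hη0 : 0 ≤ η) (hc : -Real.log (min p (1 - p)) * c / 2 ≤ η)
    (hδc : 5 * tiltConst p a * δ * (κ ^ 2 / 2) ≤ (1 - g) / 4 * c)
    (hκη : κ ^ 2 * x ^ 4 ≤ Real.exp (η * x))
    (hbig : 4 * Real.exp (-((1 - g) / 2 * c * x ^ 2)) ≤ Real.exp (-(19 / 10 * x)))
    {l : ℕ} (hl : 2 ≤ l) (hlk : l ≤ k) :
    ((k : ℝ) ^ 2 / w) ^ l * overlapBound p a δ L k l ≤ Real.exp (-(19 / 10 * x)) := by
  have hl2 : (2 : ℝ) ≤ l := by exact_mod_cast hl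
  have hlk' : (l : ℝ) ≤ k := by exact_mod_cast hlk
  have hg1 : 0 ≤ 1 - g := by linarith
  have hbase : (k : ℝ) ^ 2 / w ≤ Real.exp (-((1 - η) * x)) := by
    rw [div_le_iff₀ hw0]
    have h1 : (k : ℝ) ^ 2 ≤ (κ * x) ^ 2 := by gcongr
    have h2 : (κ * x) ^ 2 * x ^ 2 ≤ Real.exp (-((1 - η) * x)) * w * x ^ 2 := by
      calc (κ * x) ^ 2 * x ^ 2 = κ ^ 2 * x ^ 4 := by ring
        _ ≤ Real.exp (η * x) := hκη
        _ = Real.exp (-((1 - η) * x)) * Real.exp x := by rw [← Real.exp_add]; congr 1; ring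
        _ ≤ Real.exp (-((1 - η) * x)) * (w * x ^ 2) := by gcongr
        _ = _ := by ring
    exact h1.trans (le_of_mul_le_mul_right h2 (by positivity))
  have hpow : ((k : ℝ) ^ 2 / w) ^ l ≤ Real.exp (-((1 - η) * x * l)) := by
    calc ((k : ℝ) ^ 2 / w) ^ l ≤ Real.exp (-((1 - η) * x)) ^ l := by gcongr
      _ = _ := by rw [← Real.exp_nat_mul]; congr 1; ring
  have hnn := overlapBound_nonneg hp0.le hp1.le a δ L k l
  unfold overlapBound at hnn ⊢
  split_ifs at hnn ⊢ with hlL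
  · have hmin : 0 < min p (1 - p) := lt_min hp0 (by linarith)
    have hlog : 0 ≤ -Real.log (min p (1 - p)) := by
      rw [neg_nonneg]
      exact Real.log_nonpos hmin.le ((min_le_left _ _).trans hp1.le)
    have hlc : (l : ℝ) ≤ c * x := by
      by_contra! h
      rw [hL] at hlL
      exact absurd (Nat.ceil_le.2 h.le) (by omega)
    have h1 : ((min p (1 - p)) ^ l.choose 2)⁻¹ ≤ Real.exp (η * x * l) := by
      have e : ((min p (1 - p)) ^ l.choose 2)⁻¹
          = Real.exp (l.choose 2 * -Real.log (min p (1 - p))) := by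
        rw [mul_neg, Real.exp_neg, Real.exp_nat_mul, Real.exp_log hmin]
      rw [e]
      refine Real.exp_le_exp.2 ?_
      calc (l.choose 2 : ℝ) * -Real.log (min p (1 - p))
          ≤ (l * (c * x) / 2) * -Real.log (min p (1 - p)) := by
            gcongr
            refine (choose_two_le l).trans ?_
            gcongr
        _ = (-Real.log (min p (1 - p)) * c / 2) * (x * l) := by ring
        _ ≤ η * (x * l) := by gcongr
        _ = η * x * l := by ring
    calc _ ≤ Real.exp (-((1 - η) * x * l)) * Real.exp (η * x * l) := by gcongr
      _ = Real.exp (-((1 - 2 * η) * x * l)) := by rw [← Real.exp_add]; congr 1; ring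
      _ ≤ Real.exp (-(19 / 10 * x)) := by
        refine Real.exp_le_exp.2 (neg_le_neg ?_)
        -- The worst case is l = 2 and η = 1/40.
        have : 19 / 10 ≤ (1 - 2 * η) * l := by nlinarith
        calc 19 / 10 * x ≤ ((1 - 2 * η) * l) * x := by gcongr
          _ = _ := by ring
  · push Not at hlL
    have hlc : c * x ≤ l := (Nat.ceil_le.1 (hL ▸ hlL))
    have h1 : (l.choose 2 : ℝ) * rate p a ≤ g * (x * l) := by
      have hr : rate p a ≤ 2 * g / κ := by rw [le_div_iff₀ hκ]; linarith
      have hr0 : 0 ≤ 2 * g / κ := by positivity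
      calc (l.choose 2 : ℝ) * rate p a ≤ l.choose 2 * (2 * g / κ) := by gcongr
        _ ≤ (l * (κ * x) / 2) * (2 * g / κ) := by
            gcongr
            refine (choose_two_le l).trans ?_
            gcongr
            exact hlk'.trans hk
        _ = g * (x * l) := by field_simp
    have h2 : 5 * tiltConst p a * δ * k.choose 2 ≤ (1 - g) / 4 * (x * l) := by
      have ht := tiltConst_nonneg (p := p) ha0
      calc 5 * tiltConst p a * δ * k.choose 2
          ≤ 5 * tiltConst p a * δ * ((κ * x) * (κ * x) / 2) := by
            gcongr
            refine (choose_two_le k).trans ?_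
            gcongr
        _ = 5 * tiltConst p a * δ * (κ ^ 2 / 2) * x ^ 2 := by ring
        _ ≤ (1 - g) / 4 * c * x ^ 2 := by gcongr
        _ = (1 - g) / 4 * (x * (c * x)) := by ring
        _ ≤ (1 - g) / 4 * (x * l) := by gcongr
    calc _ ≤ Real.exp (-((1 - η) * x * l)) *
          (4 * Real.exp (g * (x * l) + (1 - g) / 4 * (x * l))) := by gcongr
      _ = 4 * Real.exp (-((1 - η) * x * l) + (g * (x * l) + (1 - g) / 4 * (x * l))) := by
        rw [Real.exp_add (-((1 - η) * x * l))]; ring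
      _ ≤ 4 * Real.exp (-((1 - g) / 2 * c * x ^ 2)) := by
        gcongr
        have e1 : η * (x * l) ≤ (1 - g) / 4 * (x * l) := by gcongr
        have e2 : (1 - g) / 2 * c * x ^ 2 ≤ (1 - g) / 2 * (x * l) := by
          calc (1 - g) / 2 * c * x ^ 2 = (1 - g) / 2 * (x * (c * x)) := by ring
            _ ≤ _ := by gcongr
        nlinarith
      _ ≤ _ := hbig

theorem half_le_bprob_isGood {V : Type*} [DecidableEq V] {a δ η c κ t x : ℝ} {k L : ℕ}
    (ha0 : 0 ≤ a) (ha1 : a ≤ 1) (hδ : 0 < δ) (hδ1 : δ ≤ 1) (hη : 0 < η) (hη1 : η ≤ 1)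
    (hc : 0 < c) (hx : 0 < x) (hL2 : 2 ≤ L)
    (hL : L = ⌈c * x⌉₊) (hk : (k : ℝ) ≤ κ * x) (hk' : κ * x / 2 ≤ k) (ht0 : 0 ≤ t)
    (ht : 0 < a → a * (κ * x) + η * (κ * x) ≤ t)
    (h1 : κ * x * Real.exp (-(η ^ 2 * κ / 8 * x)) ≤ 1 / 4)
    (h2 : 0 < a → 2 * Real.exp (κ * x - (a * δ * c) ^ 2 / 16 * x ^ 2) ≤ 1 / 4)
    {S : Finset V} (hS : #S = k) : 1 / 2 ≤ bprob (pairs S) a (IsGood t a δ L S) := by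
  -- At density 0 the edge set is almost surely empty, so the set is good with probability 1.
  rcases ha0.eq_or_lt with rfl | ha
  · rw [bprob_isGood_zero ht0]
    norm_num
  have ht' : a * #S + η * #S ≤ t := by
    rw [hS]
    refine le_trans ?_ (ht ha)
    gcongr
  have h := bprob_not_isGood_le ha ha1 hδ hδ1 hη hη1 ht' hL2
  rw [bprob_not, hS] at h
  have e1 : (k : ℝ) * Real.exp (-(η ^ 2 * k / 4)) ≤ 1 / 4 := by
    refine le_trans ?_ h1
    have : η ^ 2 * κ / 8 * x ≤ η ^ 2 * k / 4 := by
      calc η ^ 2 * κ / 8 * x = η ^ 2 * (κ * x / 2) / 4 := by ring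
        _ ≤ _ := by gcongr
    have hk0 : (0 : ℝ) ≤ k := Nat.cast_nonneg k
    gcongr
    exact hk0.trans hk
  have e2 : (2 : ℝ) ^ k * (2 * Real.exp (-((a * δ) ^ 2 * L.choose 2 / 4))) ≤ 1 / 4 := by
    refine le_trans ?_ (h2 ha)
    have e3 : (2 : ℝ) ^ k ≤ Real.exp (κ * x) := by
      calc (2 : ℝ) ^ k ≤ Real.exp 1 ^ k := by
            gcongr
            have := Real.add_one_le_exp 1
            linarith
        _ = Real.exp k := by rw [← Real.exp_nat_mul, mul_one]
        _ ≤ _ := Real.exp_le_exp.2 hk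
    have e4 : (a * δ * c) ^ 2 / 16 * x ^ 2 ≤ (a * δ) ^ 2 * L.choose 2 / 4 := by
      have hcL : c * x ≤ L := hL ▸ Nat.le_ceil _
      calc (a * δ * c) ^ 2 / 16 * x ^ 2 = (a * δ) ^ 2 * ((c * x) ^ 2 / 4) / 4 := by ring
        _ ≤ (a * δ) ^ 2 * ((L : ℝ) ^ 2 / 4) / 4 := by gcongr
        _ ≤ _ := by gcongr; exact le_choose_two hL2
    calc _ ≤ Real.exp (κ * x) * (2 * Real.exp (-((a * δ * c) ^ 2 / 16 * x ^ 2))) := by gcongr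
      _ = _ := by rw [sub_eq_add_neg, Real.exp_add]; ring
  linarith

/-- For τ > 0, going slightly below τ/κ keeps the rate condition by continuity and leaves room
between the typical degree and `t`. For τ = 0 there is no room below, but a = 0 needs none. -/
theorem exists_density {p τ κ : ℝ} (hp0 : 0 < p) (hp1 : p < 1) (hτ : 0 ≤ τ) (hτκ : τ / p < κ)
    (hκ : κ / 2 * rate p (τ / κ) < 1) :
    ∃ a : ℝ, 0 ≤ a ∧ a < 1 ∧ κ / 2 * rate p a < 1 ∧ (0 < a → a * κ < τ) := by
  have hκ0 : 0 < κ := lt_of_le_of_lt (by positivity) hτκ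
  rcases hτ.eq_or_lt with rfl | hτ0
  · exact ⟨0, le_rfl, one_pos, by simpa using hκ, fun h => absurd h (lt_irrefl _)⟩
  · have hpos : 0 < τ / κ := by positivity
    have hcont : Continuous fun a => κ / 2 * rate p a :=
      continuous_const.mul (continuous_rate hp0 hp1)
    have h1 : ∀ᶠ a in 𝓝[<] (τ / κ), κ / 2 * rate p a < 1 :=
      (hcont.continuousAt.eventually_lt_const hκ).filter_mono nhdsWithin_le_nhds
    have h2 : ∀ᶠ a in 𝓝[<] (τ / κ), 0 < a :=
      (eventually_gt_nhds hpos).filter_mono nhdsWithin_le_nhds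
    obtain ⟨a, ⟨ha1, ha2⟩, ha3⟩ := ((h1.and h2).and self_mem_nhdsWithin).exists
    have ha3 : a < τ / κ := ha3
    refine ⟨a, ha2.le, ?_, ha1, fun _ => (lt_div_iff₀ hκ0).1 ha3⟩
    rw [div_lt_iff₀ hp0] at hτκ
    have : τ / κ < 1 := by rw [div_lt_one hκ0]; nlinarith
    linarith

end Asymptotics

/-! ### Dependent sets inside every large vertex set. -/

section Existence

theorem eventually_mul_pow_le_exp (C : ℝ) (n : ℕ) {b : ℝ} (hb : 0 < b) :
    ∀ᶠ x : ℝ in atTop, C * x ^ n ≤ Real.exp (b * x) := by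
  have h := ((isLittleO_pow_exp_pos_mul_atTop n hb).const_mul_left C).bound one_pos
  filter_upwards [h] with x hx
  rw [one_mul, Real.norm_eq_abs, Real.norm_eq_abs, Real.abs_exp] at hx
  exact (le_abs_self _).trans hx

theorem eventually_le_const_mul (C : ℝ) {b : ℝ} (hb : 0 < b) : ∀ᶠ x : ℝ in atTop, C ≤ b * x :=
  (tendsto_id.const_mul_atTop hb).eventually_ge_atTop C

theorem card_pairs_univ_le (n : ℕ) : (#(pairs (univ : Finset (Fin n))) : ℝ) ≤ (n : ℝ) ^ 2 := by
  rw [card_pairs, card_univ, Fintype.card_fin]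
  exact_mod_cast Nat.choose_le_pow n 2

theorem tendsto_log_natCast : Tendsto (fun n : ℕ => Real.log n) atTop atTop :=
  Real.tendsto_log_atTop.comp tendsto_natCast_atTop_atTop

set_option maxHeartbeats 1000000 in
/-- A large set of vertices contains a `t`-dependent set of nearly optimal size, except with a
very small probability. -/
theorem eventually_bprob_forall_not_dependent_le {p τ κ : ℝ} (hp0 : 0 < p) (hp1 : p < 1)
    (hτ : 0 ≤ τ) (hτκ : τ / p < κ) (hκ1 : κ / 2 * rate p (τ / κ) < 1) {t : ℕ → ℝ}
    (ht : ∀ n, 0 ≤ t n) (hlim : Tendsto (fun n : ℕ => t n / Real.log n) atTop (𝓝 τ)) :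
    ∀ᶠ n : ℕ in atTop, ∀ W : Finset (Fin n), (n : ℝ) ≤ #W * Real.log n ^ 2 →
      bprob (pairs univ) p (fun A => ∀ S ∈ W.powersetCard ⌊κ * Real.log n⌋₊,
        ¬ ∀ v ∈ S, (#(A ∩ star S v) : ℝ) ≤ t n) ≤
          Real.exp (-(Real.exp (8 / 5 * Real.log n) / 64)) := by
  have hκ : 0 < κ := lt_of_le_of_lt (by positivity) hτκ
  obtain ⟨a, ha0, ha1, hrate, haτ⟩ := exists_density hp0 hp1 hτ hτκ hκ1
  -- The maximum with 0 supplies `0 ≤ g` without a proof that the rate is nonnegative.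
  set g := max (κ / 2 * rate p a) 0 with hg
  have hg1 : 0 < 1 - g := sub_pos.2 (max_lt hrate one_pos)
  have hg0 : 0 ≤ g := le_max_right _ _
  set η := min (1 / 40) ((1 - g) / 4) with hη
  have hη0 : 0 < η := lt_min (by norm_num) (by linarith)
  have hmin : 0 < min p (1 - p) := lt_min hp0 (by linarith)
  have hβ : 0 < -Real.log (min p (1 - p)) :=
    neg_pos.2 (Real.log_neg hmin ((min_le_left _ _).trans_lt hp1))
  -- The first bound gives L ≤ k; the second makes the crude correlation factor harmless for
  -- overlaps below `L`.
  set c := min (κ / 2) (2 * η / -Real.log (min p (1 - p))) with hc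
  have hc0 : 0 < c := lt_min (by linarith) (by positivity)
  have hcβ : -Real.log (min p (1 - p)) * c / 2 ≤ η := by
    have : c * -Real.log (min p (1 - p)) ≤ 2 * η := (le_div_iff₀ hβ).1 (min_le_right _ _)
    linarith
  have hcκ : c ≤ κ / 2 := min_le_left _ _
  set K := 5 * tiltConst p a * (κ ^ 2 / 2) with hK
  have hK0 : 0 ≤ K := by have := tiltConst_nonneg (p := p) ha0; positivity
  -- Small enough that the tilting errors use only part of the surplus 1 - g; `K + 1` avoids
  -- division by zero when K = 0.
  set δ := min 1 ((1 - g) / 4 * c / (K + 1)) with hδ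
  have hδ0 : 0 < δ := lt_min one_pos (by positivity)
  have hδc : 5 * tiltConst p a * δ * (κ ^ 2 / 2) ≤ (1 - g) / 4 * c := by
    have h1 : δ * (K + 1) ≤ (1 - g) / 4 * c :=
      (le_div_iff₀ (by positivity)).1 (min_le_right _ _)
    calc _ = δ * K := by rw [hK]; ring
      _ ≤ δ * (K + 1) := by gcongr; linarith
      _ ≤ _ := h1
  obtain ⟨θ, hθ0, hθ1, hθ⟩ : ∃ θ : ℝ, 0 < θ ∧ θ ≤ 1 ∧ (0 < a → a * κ + θ * κ < τ) := by
    by_cases ha : 0 < a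
    · have h := haτ ha
      have h2 : 0 < τ - a * κ := by linarith
      refine ⟨min 1 ((τ - a * κ) / (2 * κ)), lt_min one_pos (by positivity), min_le_left _ _,
        fun _ => ?_⟩
      have := (le_div_iff₀ (by positivity)).1 (min_le_right 1 ((τ - a * κ) / (2 * κ)))
      linarith
    · exact ⟨1, one_pos, le_rfl, fun h => absurd h ha⟩
  have hx : ∀ᶠ x : ℝ in atTop, 1 ≤ x ∧ 2 ≤ c * x ∧ κ * x ^ 3 ≤ Real.exp (1 * x) ∧
      κ ^ 2 * x ^ 4 ≤ Real.exp (η * x) ∧ 2 ≤ (1 - g) / 2 * c * x ∧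
      4 * x ^ 0 ≤ Real.exp (1 / 10 * x) ∧ 4 * κ * x ^ 1 ≤ Real.exp (θ ^ 2 * κ / 8 * x) ∧
      (0 < a → κ + 1 ≤ (a * δ * c) ^ 2 / 16 * x) ∧ 8 * x ^ 0 ≤ Real.exp (1 * x) ∧
      κ * x ^ 1 ≤ Real.exp (1 / 10 * x) := by
    refine (eventually_ge_atTop 1).and <| (eventually_le_const_mul _ hc0).and <|
      (eventually_mul_pow_le_exp _ _ one_pos).and <|
      (eventually_mul_pow_le_exp _ _ hη0).and <|
      (eventually_le_const_mul _ (by positivity)).and <|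
      (eventually_mul_pow_le_exp _ _ (by norm_num)).and <|
      (eventually_mul_pow_le_exp _ _ (by positivity)).and <| .and ?_ <|
      (eventually_mul_pow_le_exp _ _ one_pos).and (eventually_mul_pow_le_exp _ _ (by norm_num))
    by_cases ha : 0 < a
    · exact (eventually_le_const_mul (κ + 1) (b := (a * δ * c) ^ 2 / 16) (by positivity)).mono
        fun x hx _ => hx
    · exact .of_forall fun x h => absurd h ha
  have htn : ∀ᶠ n : ℕ in atTop, 0 < a → a * κ + θ * κ < t n / Real.log n := by
    by_cases ha : 0 < a
    · exact (hlim.eventually_const_lt (hθ ha)).mono fun n hn _ => hn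
    · exact .of_forall fun x h => absurd h ha
  filter_upwards [tendsto_log_natCast.eventually hx, htn, eventually_gt_atTop 0]
    with n ⟨e1, e2, e3, e4, e5, e6, e7, e8, e9, e10⟩ htn hn W hW
  set x := Real.log n with hxn
  have hx0 : 0 < x := by linarith
  have hnx : (n : ℝ) = Real.exp x := (Real.exp_log (by exact_mod_cast hn)).symm
  rw [pow_zero, mul_one] at e6 e9
  rw [pow_one] at e7 e10
  rw [one_mul] at e3 e9
  set k := ⌊κ * x⌋₊ with hkdef
  set L := ⌈c * x⌉₊ with hLdef
  have hκx : 4 ≤ κ * x := by nlinarith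
  have hk : (k : ℝ) ≤ κ * x := Nat.floor_le (by positivity)
  have hk1 : κ * x < k + 1 := Nat.lt_floor_add_one _
  have hk' : κ * x / 2 ≤ k := by linarith
  have hcL : c * x ≤ L := Nat.le_ceil _
  have hL2 : 2 ≤ L := by
    have : (2 : ℝ) ≤ L := e2.trans hcL
    exact_mod_cast this
  have hLk : L ≤ k := by
    have h1 : (L : ℝ) < c * x + 1 := Nat.ceil_lt_add_one (by positivity)
    have h2 : c * x ≤ κ / 2 * x := by gcongr
    have : (L : ℝ) < k + 1 := by linarith
    exact Nat.lt_succ_iff.1 (by exact_mod_cast this)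
  have hk0 : 0 < k := by omega
  have hk0' : (0 : ℝ) < k := by exact_mod_cast hk0
  rw [hnx] at hW
  have hkW' : (k : ℝ) ≤ #W := by
    refine le_of_mul_le_mul_right (a := x ^ 2) ?_ (by positivity)
    calc k * x ^ 2 ≤ κ * x * x ^ 2 := by gcongr
      _ = κ * x ^ 3 := by ring
      _ ≤ _ := e3.trans hW
  have hkW : k ≤ #W := by exact_mod_cast hkW'
  have hW0 : (0 : ℝ) < #W := hk0'.trans_le hkW'
  -- The overlap estimate gives n^(-19/10), and k ≤ n^(1/10) absorbs the division by k. Then kρ =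
  -- n^(-9/5), and with N = n² the exponent is (n^(9/5)/4)²/(4n²) = n^(8/5)/64.
  set ρ := Real.exp (-(9 / 5 * x)) / k with hρ
  have hkρ : k * ρ = Real.exp (-(9 / 5 * x)) := by rw [hρ]; field_simp
  have hy : 1 / (4 * (k * ρ)) = Real.exp (9 / 5 * x) / 4 := by
    rw [hkρ, Real.exp_neg]; field_simp
  have hE2 : Real.exp x ^ 2 = Real.exp (2 * x) := by rw [← Real.exp_nat_mul]; norm_num
  have hmain := bprob_forall_not_isGood_le (t := t n) (δ := δ) (ρ := ρ)
    (N := Real.exp x ^ 2) hp0 hp1 ha0 ha1 hδ0.le (hL2.trans hLk) hLk hkW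
    (pairs_mono (subset_univ W)) (by positivity) (hnx ▸ card_pairs_univ_le n) ?_ (by positivity)
    ?_ ?_
  · refine (bprob_mono hp0.le hp1.le fun A _ hA S hS hG => hA S hS hG.1).trans (hmain.trans_eq ?_)
    congr 2
    have h1 : Real.exp (9 / 5 * x) ^ 2 = Real.exp (8 / 5 * x) * Real.exp (2 * x) := by
      rw [← Real.exp_nat_mul, ← Real.exp_add]; congr 1; push_cast; ring
    rw [hy, hE2, div_pow, h1]
    field_simp
    norm_num
  · intro S hS
    refine half_le_bprob_isGood ha0 ha1.le hδ0 (min_le_left _ _) hθ0 hθ1 hc0 hx0 hL2 hLdef hk hk'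
      (ht n) (fun ha => ?_) ?_ (fun ha => ?_) hS
    · have := (lt_div_iff₀ hx0).1 (htn ha)
      linarith
    · rw [Real.exp_neg, ← div_eq_mul_inv, div_le_iff₀ (Real.exp_pos _)]
      linarith
    · have h1 : κ * x - (a * δ * c) ^ 2 / 16 * x ^ 2 ≤ -x := by
        have h := mul_le_mul_of_nonneg_right (e8 ha) hx0.le
        calc _ = κ * x - (a * δ * c) ^ 2 / 16 * x * x := by ring
          _ ≤ κ * x - (κ + 1) * x := by gcongr
          _ = -x := by ring
      calc _ ≤ 2 * Real.exp (-x) := by gcongr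
        _ ≤ 1 / 4 := by
          rw [Real.exp_neg, ← div_eq_mul_inv, div_le_iff₀ (Real.exp_pos _)]
          linarith
  · intro l hl hlk
    refine (pow_mul_overlapBound_le (g := g) (η := η) hp0 hp1 ha0 hδ0.le hx0 hκ hk hW0 hW hLdef
      (le_max_left _ _) hg0 (min_le_left _ _) (min_le_right _ _) hη0.le hcβ hδc e4 ?_
      hl hlk).trans ?_
    · have h1 : 2 * x ≤ (1 - g) / 2 * c * x ^ 2 := by nlinarith
      calc 4 * Real.exp (-((1 - g) / 2 * c * x ^ 2))
          ≤ Real.exp (1 / 10 * x) * Real.exp (-(2 * x)) := by gcongr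
        _ = _ := by rw [← Real.exp_add]; congr 1; ring
    · rw [hρ, le_div_iff₀ hk0']
      calc Real.exp (-(19 / 10 * x)) * k ≤ Real.exp (-(19 / 10 * x)) * Real.exp (1 / 10 * x) := by
            gcongr
            exact hk.trans e10
        _ = _ := by rw [← Real.exp_add]; congr 1; ring
  · rw [hy, hE2]
    have : Real.exp (9 / 5 * x) ≤ Real.exp (2 * x) := Real.exp_le_exp.2 (by linarith)
    have := Real.exp_pos (2 * x)
    linarith

/-- Asymptotically almost surely, all large sets of vertices contain a `t`-dependent set of nearly
optimal size. -/
theorem tendsto_bprob_exists_not_dependent {p τ κ : ℝ} (hp0 : 0 < p) (hp1 : p < 1)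
    (hτ : 0 ≤ τ) (hτκ : τ / p < κ) (hκ1 : κ / 2 * rate p (τ / κ) < 1) {t : ℕ → ℝ}
    (ht : ∀ n, 0 ≤ t n) (hlim : Tendsto (fun n : ℕ => t n / Real.log n) atTop (𝓝 τ)) :
    Tendsto (fun n : ℕ => bprob (pairs (univ : Finset (Fin n))) p fun A =>
      ∃ W : Finset (Fin n), (n : ℝ) ≤ #W * Real.log n ^ 2 ∧
        ∀ S ∈ W.powersetCard ⌊κ * Real.log n⌋₊, ¬ ∀ v ∈ S, (#(A ∩ star S v) : ℝ) ≤ t n)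
      atTop (𝓝 0) := by
  have hlim0 : Tendsto (fun n : ℕ => Real.exp (-Real.log n)) atTop (𝓝 0) :=
    Real.tendsto_exp_neg_atTop_nhds_zero.comp tendsto_log_natCast
  refine squeeze_zero' (.of_forall fun n => bprob_nonneg hp0.le hp1.le) ?_ hlim0
  have hx : ∀ᶠ x : ℝ in atTop, 0 ≤ x ∧ 128 * x ^ 0 ≤ Real.exp (3 / 5 * x) :=
    (eventually_ge_atTop 0).and (eventually_mul_pow_le_exp _ _ (by norm_num))
  filter_upwards [eventually_bprob_forall_not_dependent_le hp0 hp1 hτ hτκ hκ1 ht hlim,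
    tendsto_log_natCast.eventually hx, eventually_gt_atTop 0] with n hbound ⟨hx0, hx⟩ hn
  set x := Real.log n with hxn
  have hnx : (n : ℝ) = Real.exp x := (Real.exp_log (by exact_mod_cast hn)).symm
  rw [pow_zero, mul_one] at hx
  calc _ ≤ bprob (pairs (univ : Finset (Fin n))) p fun A =>
        ∃ W ∈ (univ : Finset (Finset (Fin n))).filter fun W => (n : ℝ) ≤ #W * x ^ 2,
          ∀ S ∈ W.powersetCard ⌊κ * x⌋₊, ¬ ∀ v ∈ S, (#(A ∩ star S v) : ℝ) ≤ t n :=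
        bprob_mono hp0.le hp1.le fun A _ ⟨W, hW, h⟩ => ⟨W, by simpa using hW, h⟩
    _ ≤ ∑ W ∈ (univ : Finset (Finset (Fin n))).filter fun W => (n : ℝ) ≤ #W * x ^ 2,
          Real.exp (-(Real.exp (8 / 5 * x) / 64)) :=
        (bprob_exists_le hp0.le hp1.le _ _).trans
          (sum_le_sum fun W hW => hbound W (mem_filter.1 hW).2)
    _ ≤ 2 ^ n * Real.exp (-(Real.exp (8 / 5 * x) / 64)) := by
        rw [sum_const, nsmul_eq_mul]
        have h1 := card_filter_le (univ : Finset (Finset (Fin n)))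
          fun W => (n : ℝ) ≤ #W * x ^ 2
        rw [card_univ, Fintype.card_finset, Fintype.card_fin] at h1
        have h2 : (#((univ : Finset (Finset (Fin n))).filter
          fun W => (n : ℝ) ≤ #W * x ^ 2) : ℝ) ≤ 2 ^ n := by exact_mod_cast h1
        gcongr
    _ ≤ Real.exp n * Real.exp (-(Real.exp (8 / 5 * x) / 64)) := by
        have : (2 : ℝ) ^ n ≤ Real.exp n := by
          calc (2 : ℝ) ^ n ≤ Real.exp 1 ^ n := by
                gcongr
                have := Real.add_one_le_exp 1
                linarith
            _ = _ := by rw [← Real.exp_nat_mul, mul_one]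
        gcongr
    _ ≤ Real.exp (-x) := by
        rw [← Real.exp_add, hnx]
        refine Real.exp_le_exp.2 ?_
        have h1 : Real.exp (8 / 5 * x) = Real.exp (3 / 5 * x) * Real.exp x := by
          rw [← Real.exp_add]; congr 1; ring
        have h2 := mul_le_mul_of_nonneg_right hx (Real.exp_pos x).le
        have h3 := Real.add_one_le_exp x
        rw [h1]
        linarith

end Existence

/-! ### Dependent sets and greedy colouring. -/

section Dependent

variable {V : Type*} [DecidableEq V]

/-- `S` induces a graph of maximum degree at most `t` in the graph with edge set `A`. -/
def IsDependentIn (t : ℝ) (A : Finset (Sym2 V)) (S : Finset V) : Prop :=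
  ∀ v ∈ S, (#(A ∩ star S v) : ℝ) ≤ t

variable {t : ℝ} {A : Finset (Sym2 V)} {S T W : Finset V}

theorem IsDependentIn.mono (h : IsDependentIn t A T) (hST : S ⊆ T) : IsDependentIn t A S :=
  fun v hv => le_trans (by
    have : star S v ⊆ star T v := image_subset_image (erase_subset_erase v hST)
    exact_mod_cast card_le_card (inter_subset_inter_left this)) (h v (hST hv))

theorem isDependentIn_of_card_le_one (ht : 0 ≤ t) (hS : #S ≤ 1) : IsDependentIn t A S :=
  fun v hv => by
    have h : #(star S v) = 0 := by rw [card_star hv]; omega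
    rw [card_eq_zero.1 h]
    simpa using ht

theorem two_mul_card_inter_pairs (A : Finset (Sym2 V)) (S : Finset V) :
    2 * #(A ∩ pairs S) = ∑ v ∈ S, #(A ∩ star S v) := by
  have h1 : ∀ v ∈ S, A ∩ star S v = (A ∩ pairs S).filter fun e => v ∈ e := fun v hv => by
    ext e
    induction e with | _ x y
    simp only [mem_inter, mem_filter, mk_mem_pairs, star, mem_image, mem_erase, Sym2.eq_iff,
      Sym2.mem_iff]
    constructor
    · rintro ⟨hA, w, ⟨hne, hw⟩, ⟨rfl, rfl⟩ | ⟨rfl, rfl⟩⟩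
      · exact ⟨⟨hA, ⟨hv, hw⟩, hne.symm⟩, Or.inl rfl⟩
      · exact ⟨⟨hA, ⟨hw, hv⟩, hne⟩, Or.inr rfl⟩
    · rintro ⟨⟨hA, ⟨hx, hy⟩, hne⟩, rfl | rfl⟩
      · exact ⟨hA, y, ⟨hne.symm, hy⟩, Or.inl ⟨rfl, rfl⟩⟩
      · exact ⟨hA, x, ⟨hne, hx⟩, Or.inr ⟨rfl, rfl⟩⟩
  have h2 : ∀ e ∈ A ∩ pairs S, #(S.filter fun v => v ∈ e) = 2 := fun e he => by
    induction e with | _ x y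
    rw [mem_inter, mk_mem_pairs] at he
    rw [card_eq_two]
    refine ⟨x, y, he.2.2, ?_⟩
    ext v
    simp only [mem_filter, Sym2.mem_iff, mem_insert, mem_singleton]
    constructor
    · exact fun h => h.2
    · rintro (rfl | rfl)
      · exact ⟨he.2.1.1, Or.inl rfl⟩
      · exact ⟨he.2.1.2, Or.inr rfl⟩
  rw [sum_congr rfl fun v hv => by rw [h1 v hv]]
  have := sum_card_bipartiteAbove_eq_sum_card_bipartiteBelow (s := S) (t := A ∩ pairs S)
    fun v e => v ∈ e
  simp only [bipartiteAbove, bipartiteBelow] at this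
  rw [this, sum_congr rfl h2, sum_const, smul_eq_mul, mul_comm]

theorem IsDependentIn.card_inter_pairs_le (h : IsDependentIn t A S) :
    2 * (#(A ∩ pairs S) : ℝ) ≤ #S * t := by
  calc 2 * (#(A ∩ pairs S) : ℝ) = ∑ v ∈ S, (#(A ∩ star S v) : ℝ) := by
        exact_mod_cast two_mul_card_inter_pairs A S
    _ ≤ ∑ v ∈ S, t := sum_le_sum h
    _ = #S * t := by rw [sum_const, nsmul_eq_mul]

theorem exists_colouring_of_card_le (ht : 0 ≤ t) {M j : ℕ} (hW : #W ≤ M) :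
    ∃ c : V → ℕ, (∀ v ∈ W, c v < j + M) ∧ ∀ i, IsDependentIn t A (W.filter fun v => c v = i) := by
  refine ⟨fun v => if h : v ∈ W then W.equivFin ⟨v, h⟩ else 0, fun v hv => ?_, fun i => ?_⟩
  · simp only [hv, dif_pos]
    have := (W.equivFin ⟨v, hv⟩).2
    omega
  · refine isDependentIn_of_card_le_one ht (card_le_one.2 fun v hv w hw => ?_)
    rw [mem_filter] at hv hw
    have h := hv.2.trans hw.2.symm
    simp only [hv.1, hw.1, dif_pos] at h
    simpa using W.equivFin.injective (Fin.ext h)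

/-- Remove dependent `k`-sets as colour classes while at least `M` vertices remain, then give every
remaining vertex its own colour. -/
theorem exists_colouring_of_forall_exists {k M : ℕ} (ht : 0 ≤ t)
    (h : ∀ W : Finset V, M ≤ #W → ∃ S ∈ W.powersetCard k, IsDependentIn t A S) (j : ℕ)
    (W : Finset V) (hW : #W ≤ j * k + M) :
    ∃ c : V → ℕ, (∀ v ∈ W, c v < j + M) ∧ ∀ i, IsDependentIn t A (W.filter fun v => c v = i) := by
  induction j generalizing W with
  | zero => exact exists_colouring_of_card_le ht (by simpa using hW)
  | succ j ih =>
    rcases le_total #W M with hM | hM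
    · exact exists_colouring_of_card_le ht hM
    obtain ⟨S, hS, hdep⟩ := h W hM
    rw [mem_powersetCard] at hS
    obtain ⟨c, hc, hcd⟩ := ih (W \ S) (by
      rw [card_sdiff_of_subset hS.1, hS.2]
      rw [add_mul, one_mul] at hW
      omega)
    refine ⟨fun v => if v ∈ S then j + M else c v, fun v hv => ?_, fun i => ?_⟩
    · beta_reduce
      split_ifs with hvS
      · omega
      · have := hc v (mem_sdiff.2 ⟨hv, hvS⟩)
        omega
    · by_cases hi : i = j + M
      · refine hdep.mono fun v hv => ?_
        rw [mem_filter] at hv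
        beta_reduce at hv
        by_contra hvS
        rw [if_neg hvS] at hv
        have := hc v (mem_sdiff.2 ⟨hv.1, hvS⟩)
        omega
      · refine (hcd i).mono fun v hv => ?_
        rw [mem_filter] at hv
        beta_reduce at hv
        by_cases hvS : v ∈ S
        · rw [if_pos hvS] at hv
          exact absurd hv.2.symm hi
        · rw [if_neg hvS] at hv
          exact mem_filter.2 ⟨mem_sdiff.2 ⟨hv.1, hvS⟩, hv.2⟩

end Dependent

/-! ### Translation to simple graphs and the binomial random graph. -/

section Graph

variable {V : Type*} [Fintype V] [DecidableEq V] {t : ℝ}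

open Classical in
/-- The edges of `G`, as a finite set. -/
noncomputable def edges (G : SimpleGraph V) : Finset (Sym2 V) :=
  univ.filter fun e => e ∈ G.edgeSet

theorem mem_edges {G : SimpleGraph V} {e : Sym2 V} : e ∈ edges G ↔ e ∈ G.edgeSet := by
  simp [edges]

theorem edges_injective : Function.Injective (edges : SimpleGraph V → Finset (Sym2 V)) :=
  fun G H h => SimpleGraph.edgeSet_injective (Set.ext fun e => by
    rw [← mem_edges, h, mem_edges])

theorem edges_subset (G : SimpleGraph V) : edges G ⊆ pairs univ := fun e he => by
  induction e with | _ x y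
  rw [mem_edges, SimpleGraph.mem_edgeSet] at he
  exact mk_mem_pairs.2 ⟨⟨mem_univ _, mem_univ _⟩, he.ne⟩

-- Expressing degrees by `ncard` removes the decidability instances hidden in `maxDegree`.
open Classical in
theorem isDependent_iff_ncard (G : SimpleGraph V) (ht : 0 ≤ t) (S : Set V) :
    IsDependent G t S ↔ ∀ v : S, (((G.induce S).neighborSet v).ncard : ℝ) ≤ t := by
  have h : ∀ v : S, ((G.induce S).neighborSet v).ncard = (G.induce S).degree v := fun v => by
    rw [Set.ncard_eq_toFinset_card', ← SimpleGraph.card_neighborFinset_eq_degree]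
    rfl
  simp only [h, IsDependent, ← Nat.le_floor_iff ht]
  exact ⟨fun hm v => (SimpleGraph.degree_le_maxDegree _ v).trans hm,
    fun hv => SimpleGraph.maxDegree_le_of_forall_degree_le _ _ hv⟩

theorem isDependent_iff (G : SimpleGraph V) (ht : 0 ≤ t) (S : Finset V) :
    IsDependent G t (S : Set V) ↔ IsDependentIn t (edges G) S := by
  have hdeg : ∀ (v : V) (hv : v ∈ S), #(edges G ∩ star S v) =
      ((G.induce (S : Set V)).neighborSet ⟨v, hv⟩).ncard := fun v hv => by
    rw [← Set.ncard_image_of_injective _ fun w w' h =>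
      Subtype.ext (Sym2.congr_right.1 (h : s(v, w.1) = s(v, w'.1))), ← Set.ncard_coe_finset]
    congr 1
    ext e
    simp only [mem_coe, mem_inter, star, mem_image, mem_erase, mem_edges, Set.mem_image,
      SimpleGraph.mem_neighborSet, SimpleGraph.comap_adj, Function.Embedding.subtype_apply]
    constructor
    · rintro ⟨he, w, ⟨hne, hw⟩, rfl⟩
      exact ⟨⟨w, hw⟩, he, rfl⟩
    · rintro ⟨w, hw, rfl⟩
      exact ⟨hw, w.1, ⟨hw.ne', w.2⟩, rfl⟩
  rw [isDependent_iff_ncard G ht]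
  exact ⟨fun h v hv => hdeg v hv ▸ h ⟨v, hv⟩, fun h v => hdeg v.1 v.2 ▸ h v.1 v.2⟩

theorem improperChromaticNumber_le (G : SimpleGraph V) (ht : 0 ≤ t) {k M j : ℕ}
    (h : ∀ W : Finset V, M ≤ #W → ∃ S ∈ W.powersetCard k, IsDependentIn t (edges G) S)
    (hj : Fintype.card V ≤ j * k + M) : improperChromaticNumber G t ≤ j + M := by
  obtain ⟨c, hc, hcd⟩ := exists_colouring_of_forall_exists ht h j univ hj
  refine Nat.sInf_le ⟨fun v => ⟨c v, hc v (mem_univ v)⟩, fun i => ?_⟩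
  have e : (fun v => (⟨c v, hc v (mem_univ v)⟩ : Fin (j + M))) ⁻¹' {i} =
      ((univ.filter fun v => c v = i : Finset V) : Set V) := by
    ext v
    simp [Fin.ext_iff]
  rw [e, isDependent_iff G ht]
  exact hcd i

theorem card_le_improperChromaticNumber_mul (G : SimpleGraph V) (ht : 0 ≤ t) {k : ℕ}
    (h : ∀ S : Finset V, #S = k + 1 → ¬ IsDependentIn t (edges G) S) :
    Fintype.card V ≤ improperChromaticNumber G t * k := by
  obtain ⟨c, hc⟩ : ∃ c : V → Fin (improperChromaticNumber G t), IsImproperColouring G t c :=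
    Nat.sInf_mem (exists_improperColouring G ht)
  have h1 : ∀ i ∈ (univ : Finset (Fin (improperChromaticNumber G t))),
      #((univ : Finset V).filter fun v => c v = i) ≤ k := fun i _ => by
    by_contra! hlt
    obtain ⟨S, hS, hSk⟩ := exists_subset_card_eq (Nat.succ_le_of_lt hlt)
    refine h S hSk (IsDependentIn.mono ?_ hS)
    rw [← isDependent_iff G ht]
    convert hc i
    ext v
    simp
  have h2 := card_eq_sum_card_fiberwise (f := c) (s := (univ : Finset V))
    (t := (univ : Finset (Fin (improperChromaticNumber G t)))) fun v _ => by simp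
  rw [card_univ] at h2
  rw [h2]
  exact (sum_le_card_nsmul _ _ k h1).trans_eq (by simp)

/-- An inequality suffices, since only bad events have to be bounded. -/
theorem binomialRandom_le_bprob (p : unitInterval) {𝒮 : Set (SimpleGraph V)}
    {Q : Finset (Sym2 V) → Prop} (h : ∀ G ∈ 𝒮, Q (edges G)) :
    SimpleGraph.binomialRandom V p 𝒮 ≤ ENNReal.ofReal (bprob (pairs univ) (p : ℝ) Q) := by
  classical
  have hq0 : (0 : ℝ) ≤ 1 - p := sub_nonneg.2 p.2.2
  have hsing : ∀ G : SimpleGraph V, SimpleGraph.binomialRandom V p {G} =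
      ENNReal.ofReal ((p : ℝ) ^ #(edges G) *
        (1 - (p : ℝ)) ^ (#(pairs (univ : Finset V)) - #(edges G))) := fun G => by
    have hcard : G.edgeSet.ncard = #(edges G) := by
      rw [← Set.ncard_coe_finset]
      congr 1
      ext e
      exact mem_edges.symm
    have e1 : (unitInterval.toNNReal p : ENNReal) = ENNReal.ofReal p := by
      rw [ENNReal.ofReal_eq_coe_nnreal p.2.1]; rfl
    have e2 : (unitInterval.toNNReal (unitInterval.symm p) : ENNReal) =
        ENNReal.ofReal (1 - p) := by
      rw [ENNReal.ofReal_eq_coe_nnreal hq0]; rfl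
    rw [SimpleGraph.binomialRandom_singleton, hcard, card_pairs, card_univ,
      Nat.card_eq_fintype_card, e1, e2, ENNReal.ofReal_mul (pow_nonneg p.2.1 _),
      ENNReal.ofReal_pow p.2.1, ENNReal.ofReal_pow hq0]
  have hw : ∀ k l : ℕ, 0 ≤ (p : ℝ) ^ k * (1 - (p : ℝ)) ^ l :=
    bexp_weight_nonneg p.2.1 p.2.2
  calc SimpleGraph.binomialRandom V p 𝒮
      = SimpleGraph.binomialRandom V p (⋃ G ∈ 𝒮.toFinset, {G}) := by
        congr 1; ext G; simp
    _ ≤ ∑ G ∈ 𝒮.toFinset, SimpleGraph.binomialRandom V p {G} := measure_biUnion_finset_le _ _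
    _ = ENNReal.ofReal (∑ G ∈ 𝒮.toFinset, (p : ℝ) ^ #(edges G) *
        (1 - (p : ℝ)) ^ (#(pairs (univ : Finset V)) - #(edges G))) := by
        rw [ENNReal.ofReal_sum_of_nonneg fun G _ => hw _ _]
        exact sum_congr rfl fun G _ => hsing G
    _ ≤ _ := by
        refine ENNReal.ofReal_le_ofReal ?_
        have h2 : ∑ G ∈ 𝒮.toFinset, (p : ℝ) ^ #(edges G) *
            (1 - (p : ℝ)) ^ (#(pairs (univ : Finset V)) - #(edges G)) =
            ∑ A ∈ 𝒮.toFinset.image edges, (p : ℝ) ^ #A *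
              (1 - (p : ℝ)) ^ (#(pairs (univ : Finset V)) - #A) * if Q A then 1 else 0 := by
          rw [sum_image fun G _ H _ h => edges_injective h]
          refine sum_congr rfl fun G hG => ?_
          rw [if_pos (h G (Set.mem_toFinset.1 hG)), mul_one]
        rw [h2, bprob, bexp]
        have h3 : 𝒮.toFinset.image edges ⊆ (pairs (univ : Finset V)).powerset := fun A hA => by
          obtain ⟨G, _, rfl⟩ := mem_image.1 hA
          exact mem_powerset.2 (edges_subset G)
        refine (sum_le_sum_of_subset_of_nonneg h3 fun A _ _ =>
          mul_nonneg (hw _ _) (by split_ifs <;> norm_num)).trans_eq ?_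
        exact sum_congr rfl fun A _ => by congr

end Graph

/-! ### The first moment bound. -/

section FirstMoment

/-- Summing degrees gives at most (k+1)t/2 ≤ y·C(k+1,2) edges, a density of at most `y`, to which
the Chernoff bound applies. -/
theorem bprob_isDependentIn_le {V : Type*} [DecidableEq V] {p y t : ℝ} {k : ℕ}
    (hp0 : 0 < p) (hp1 : p < 1) (hy0 : 0 < y) (hyp : y ≤ p) (ht : t ≤ y * k)
    {E : Finset (Sym2 V)} {S : Finset V} (hS : #S = k + 1) (hSE : pairs S ⊆ E) :
    bprob E p (fun A => IsDependentIn t A S) ≤ Real.exp (-((k + 1) * k / 2 * rate p y)) := by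
  have hN : (#(pairs S) : ℝ) = (k + 1) * k / 2 := by
    rw [card_pairs, hS, Nat.cast_choose_two]
    push_cast
    ring
  have hsup : SupportedOn (fun A => (#(A ∩ pairs S) : ℝ) ≤ y * #(pairs S)) (pairs S) :=
    supportedOn_inter (fun B => (#B : ℝ) ≤ y * #(pairs S)) subset_rfl
  calc bprob E p (fun A => IsDependentIn t A S)
      ≤ bprob E p (fun A => (#(A ∩ pairs S) : ℝ) ≤ y * #(pairs S)) := by
        refine bprob_mono hp0.le hp1.le fun A _ hA => ?_
        have h := hA.card_inter_pairs_le
        rw [hS] at h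
        push_cast at h
        have h2 : ((k : ℝ) + 1) * t ≤ (k + 1) * (y * k) := by gcongr
        rw [hN]
        linarith
    _ = bprob (pairs S) p (fun A => (#(A ∩ pairs S) : ℝ) ≤ y * #(pairs S)) := hsup.bprob_eq hSE
    _ ≤ bprob (pairs S) p (fun A => (#A : ℝ) ≤ y * #(pairs S)) :=
        bprob_mono hp0.le hp1.le fun A hA h => by rwa [inter_eq_left.2 hA] at h
    _ ≤ _ := bprob_card_le_le_exp hp0 hp1 hy0 hyp _
    _ = _ := by rw [hN]

/-- Going slightly above τ/κ leaves room for the rounding of k and for the error in t/ln n, and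
makes `y` positive even when τ = 0. -/
theorem exists_density_above {p τ κ : ℝ} (hp0 : 0 < p) (hp1 : p < 1) (hτ : 0 ≤ τ)
    (hτκ : τ / p < κ) (hκ : 1 < κ / 2 * rate p (τ / κ)) :
    ∃ y : ℝ, 0 < y ∧ y ≤ p ∧ 1 < κ / 2 * rate p y ∧ τ < y * κ := by
  have hκ0 : 0 < κ := lt_of_le_of_lt (by positivity) hτκ
  have hτp : τ / κ < p := by
    rw [div_lt_iff₀ hp0] at hτκ
    rw [div_lt_iff₀ hκ0]
    linarith
  have hcont : Continuous fun a => κ / 2 * rate p a :=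
    continuous_const.mul (continuous_rate hp0 hp1)
  have h1 : ∀ᶠ y in 𝓝[>] (τ / κ), 1 < κ / 2 * rate p y :=
    (hcont.continuousAt.eventually_const_lt hκ).filter_mono nhdsWithin_le_nhds
  have h2 : ∀ᶠ y in 𝓝[>] (τ / κ), y < p :=
    (eventually_lt_nhds hτp).filter_mono nhdsWithin_le_nhds
  obtain ⟨y, ⟨hy1, hy2⟩, hy3⟩ := ((h1.and h2).and self_mem_nhdsWithin).exists
  have hy3 : τ / κ < y := hy3
  exact ⟨y, lt_of_le_of_lt (by positivity) hy3, hy2.le, hy1, (div_lt_iff₀ hκ0).1 hy3⟩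

/-- Asymptotically almost surely, there are no `t`-dependent sets of more than the optimal size. -/
theorem tendsto_bprob_exists_dependent {p τ κ : ℝ} (hp0 : 0 < p) (hp1 : p < 1)
    (hτ : 0 ≤ τ) (hτκ : τ / p < κ) (hκ1 : 1 < κ / 2 * rate p (τ / κ)) {t : ℕ → ℝ}
    (hlim : Tendsto (fun n : ℕ => t n / Real.log n) atTop (𝓝 τ)) :
    Tendsto (fun n : ℕ => bprob (pairs (univ : Finset (Fin n))) p fun A =>
      ∃ S : Finset (Fin n), #S = ⌊κ * Real.log n⌋₊ + 1 ∧ IsDependentIn (t n) A S)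
      atTop (𝓝 0) := by
  have hκ : 0 < κ := lt_of_le_of_lt (by positivity) hτκ
  obtain ⟨y, hy0, hyp, hrate, hyτ⟩ := exists_density_above hp0 hp1 hτ hτκ hκ1
  set s := κ / 2 * rate p y - 1 with hs
  have hs0 : 0 < s := by linarith
  have hr0 : 0 < rate p y := by
    by_contra! h
    have : κ / 2 * rate p y ≤ 0 := mul_nonpos_of_nonneg_of_nonpos (by positivity) h
    linarith
  have hlim0 : Tendsto (fun n : ℕ => Real.exp (-(s / 2 * Real.log n))) atTop (𝓝 0) :=
    Real.tendsto_exp_neg_atTop_nhds_zero.comp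
      (tendsto_log_natCast.const_mul_atTop (by positivity))
  refine squeeze_zero' (.of_forall fun n => bprob_nonneg hp0.le hp1.le) ?_ hlim0
  set σ := (y * κ - τ) / 2 with hσ
  have hσ0 : 0 < σ := by rw [hσ]; linarith
  have hx : ∀ᶠ x : ℝ in atTop, 1 ≤ x ∧ rate p y / 2 ≤ s / 2 * x ∧ y ≤ σ * x :=
    (eventually_ge_atTop 1).and <| (eventually_le_const_mul _ (by positivity)).and
      (eventually_le_const_mul _ hσ0)
  filter_upwards [tendsto_log_natCast.eventually hx, eventually_gt_atTop 0,
    hlim.eventually_lt_const (show τ < τ + σ by linarith)] with n ⟨hx1, hx2, hx3⟩ hn htn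
  set x := Real.log n with hxn
  have hx0 : 0 < x := by linarith
  have hnx : (n : ℝ) = Real.exp x := (Real.exp_log (by exact_mod_cast hn)).symm
  set k := ⌊κ * x⌋₊ with hk
  have hk1 : κ * x < k + 1 := Nat.lt_floor_add_one _
  have htk : t n ≤ y * k := by
    rw [div_lt_iff₀ hx0] at htn
    have h1 : y * (κ * x) ≤ y * (k + 1) := by gcongr
    have h2 : (τ + σ) * x + σ * x = y * (κ * x) := by rw [hσ]; ring
    linarith
  calc _ ≤ bprob (pairs (univ : Finset (Fin n))) p fun A =>
        ∃ S ∈ (univ : Finset (Fin n)).powersetCard (k + 1), IsDependentIn (t n) A S :=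
        bprob_mono hp0.le hp1.le fun A _ ⟨S, hS, h⟩ => ⟨S, by simpa using hS, h⟩
    _ ≤ ∑ S ∈ (univ : Finset (Fin n)).powersetCard (k + 1),
          Real.exp (-((k + 1) * k / 2 * rate p y)) :=
        (bprob_exists_le hp0.le hp1.le _ _).trans (sum_le_sum fun S hS =>
          bprob_isDependentIn_le hp0 hp1 hy0 hyp htk (mem_powersetCard.1 hS).2
            (pairs_mono (subset_univ _)))
    _ ≤ Real.exp x ^ (k + 1) * Real.exp (-((k + 1) * k / 2 * rate p y)) := by
        rw [sum_const, nsmul_eq_mul, card_powersetCard, card_univ, Fintype.card_fin, ← hnx]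
        gcongr
        exact_mod_cast Nat.choose_le_pow n (k + 1)
    _ = Real.exp ((k + 1) * (x - k / 2 * rate p y)) := by
        rw [← Real.exp_nat_mul, ← Real.exp_add]
        congr 1
        push_cast
        ring
    _ ≤ Real.exp (-(s / 2 * x)) := by
        refine Real.exp_le_exp.2 ?_
        -- Rounding κx down costs at most `rate p y / 2`, which half of the surplus `s * x` absorbs.
        have h1 : x - k / 2 * rate p y ≤ -(s / 2 * x) := by
          have : (κ * x - 1) / 2 * rate p y ≤ k / 2 * rate p y := by gcongr; linarith
          have h2 : (κ * x - 1) / 2 * rate p y = (1 + s) * x - rate p y / 2 := by rw [hs]; ring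
          linarith
        have h3 : (0 : ℝ) ≤ k := Nat.cast_nonneg k
        have h4 : 0 ≤ s / 2 * x := by positivity
        calc (k + 1) * (x - k / 2 * rate p y) ≤ ((k : ℝ) + 1) * -(s / 2 * x) := by gcongr
          _ ≤ _ := by nlinarith

end FirstMoment

/-! ### From set sizes to numbers of colours. -/

section Bounds

/-- If large sets contain dependent sets of size `k ≈ κ₁ log n`, then about `n / k` colours
suffice. -/
theorem eventually_improperChromaticNumber_le {κ κ₁ ε : ℝ} (hκ : 0 < κ) (hκ₁ : 0 < κ₁)
    (hε : κ < (1 + ε) * κ₁) {t : ℕ → ℝ} (ht : ∀ n, 0 ≤ t n) :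
    ∀ᶠ n : ℕ in atTop, ∀ G : SimpleGraph (Fin n),
      (∀ W : Finset (Fin n), (n : ℝ) ≤ #W * Real.log n ^ 2 →
        ∃ S ∈ W.powersetCard ⌊κ₁ * Real.log n⌋₊, IsDependentIn (t n) (edges G) S) →
      (improperChromaticNumber G (t n) : ℝ) ≤ (1 + ε) * (n / (κ * Real.log n)) := by
  -- The bound n/(κ₁x - 1) + n/x² + 2 on the number of colours, divided by n/(κx); the constant 2
  -- comes from the two ceilings.
  have hF : Tendsto (fun x : ℝ => κ / (κ₁ - x⁻¹) + κ * x⁻¹ + 2 * κ * (x ^ 1 * Real.exp (-x)))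
      atTop (𝓝 (κ / (κ₁ - 0) + κ * 0 + 2 * κ * 0)) := by
    refine Tendsto.add (Tendsto.add ?_ (tendsto_inv_atTop_zero.const_mul κ))
      ((Real.tendsto_pow_mul_exp_neg_atTop_nhds_zero 1).const_mul _)
    exact tendsto_const_nhds.div (tendsto_const_nhds.sub tendsto_inv_atTop_zero)
      (by simpa using hκ₁.ne')
  rw [sub_zero, mul_zero, mul_zero, add_zero, add_zero] at hF
  have hx : ∀ᶠ x : ℝ in atTop, 1 ≤ x ∧ 2 ≤ κ₁ * x ∧
      κ / (κ₁ - x⁻¹) + κ * x⁻¹ + 2 * κ * (x ^ 1 * Real.exp (-x)) < 1 + ε :=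
    (eventually_ge_atTop 1).and <| (eventually_le_const_mul _ hκ₁).and <|
      hF.eventually_lt_const ((div_lt_iff₀ hκ₁).2 hε)
  filter_upwards [tendsto_log_natCast.eventually hx, eventually_gt_atTop 0]
    with n ⟨hx1, hx2, hx3⟩ hn G hG
  set x := Real.log n with hxn
  have hx0 : 0 < x := by linarith
  have hn0 : (0 : ℝ) < n := by exact_mod_cast hn
  have hnx : (n : ℝ) = Real.exp x := (Real.exp_log hn0).symm
  set k := ⌊κ₁ * x⌋₊ with hk
  have hk1 : κ₁ * x - 1 ≤ k := by
    have := Nat.lt_floor_add_one (κ₁ * x)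
    linarith
  have hpos : 0 < κ₁ * x - 1 := by linarith
  have hk0 : (0 : ℝ) < k := hpos.trans_le hk1
  set M := ⌈(n : ℝ) / x ^ 2⌉₊ with hM
  set j := ⌈(n : ℝ) / k⌉₊ with hj
  have h1 : improperChromaticNumber G (t n) ≤ j + M := by
    refine improperChromaticNumber_le (k := k) G (ht n) (fun W hW => hG W ?_) ?_
    · have h2 : (n : ℝ) / x ^ 2 ≤ #W := (Nat.le_ceil _).trans (by exact_mod_cast hW)
      exact (div_le_iff₀ (by positivity)).1 h2
    · rw [Fintype.card_fin]
      have h2 : (n : ℝ) ≤ j * k := (div_le_iff₀ hk0).1 (Nat.le_ceil _)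
      have h3 : n ≤ j * k := by exact_mod_cast h2
      omega
  have hj1 : (j : ℝ) ≤ n / (κ₁ * x - 1) + 1 := by
    have h2 : (j : ℝ) < n / k + 1 := Nat.ceil_lt_add_one (by positivity)
    have h3 : (n : ℝ) / k ≤ n / (κ₁ * x - 1) := by gcongr
    linarith
  have hM1 : (M : ℝ) ≤ n / x ^ 2 + 1 := (Nat.ceil_lt_add_one (by positivity)).le
  calc (improperChromaticNumber G (t n) : ℝ) ≤ j + M := by exact_mod_cast h1
    _ ≤ n / (κ₁ * x - 1) + n / x ^ 2 + 2 := by linarith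
    _ = (κ / (κ₁ - x⁻¹) + κ * x⁻¹ + 2 * κ * (x ^ 1 * Real.exp (-x))) * (n / (κ * x)) := by
        have e1 : κ / (κ₁ - x⁻¹) = κ * x / (κ₁ * x - 1) := by
          have : κ₁ - x⁻¹ = (κ₁ * x - 1) / x := by field_simp
          rw [this, div_div_eq_mul_div]
        rw [e1, Real.exp_neg, ← hnx]
        field_simp
    _ ≤ (1 + ε) * (n / (κ * x)) := by gcongr

/-- If there are no dependent sets of size larger than `κ₂ log n`, then at least
`n / (κ₂ log n)` colours are needed. -/
theorem le_improperChromaticNumber {κ ε t : ℝ} (hκ : 0 < κ) (hε : 0 < ε) (ht : 0 ≤ t) {n : ℕ}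
    (hx : 0 < Real.log n) (G : SimpleGraph (Fin n))
    (h : ∀ S : Finset (Fin n), #S = ⌊κ * (1 + ε) * Real.log n⌋₊ + 1 →
      ¬ IsDependentIn t (edges G) S) :
    (1 - ε) * (n / (κ * Real.log n)) ≤ (improperChromaticNumber G t : ℝ) := by
  have h1 := card_le_improperChromaticNumber_mul G ht h
  rw [Fintype.card_fin] at h1
  set x := Real.log n with hxn
  set X : ℝ := (improperChromaticNumber G t : ℝ) with hX
  have hX0 : 0 ≤ X := Nat.cast_nonneg _
  have h2 : (n : ℝ) ≤ X * (κ * (1 + ε) * x) := by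
    have h3 : (n : ℝ) ≤ X * ⌊κ * (1 + ε) * x⌋₊ := by rw [hX]; exact_mod_cast h1
    refine h3.trans ?_
    gcongr
    exact Nat.floor_le (by positivity)
  have h4 : (n : ℝ) / (κ * x) ≤ X * (1 + ε) := by
    rw [div_le_iff₀ (by positivity)]
    linarith
  have h5 : (0 : ℝ) ≤ n / (κ * x) := by positivity
  -- For ε ≤ 1 this is (1-ε)(1+ε) ≤ 1; for larger ε the left side is not positive.
  rcases le_total ε 1 with h6 | h6
  · calc (1 - ε) * (n / (κ * x)) ≤ (1 - ε) * (X * (1 + ε)) := by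
          have : 0 ≤ 1 - ε := by linarith
          gcongr
      _ = X - ε ^ 2 * X := by ring
      _ ≤ X := by
          have : 0 ≤ ε ^ 2 * X := by positivity
          linarith
  · exact (mul_nonpos_of_nonpos_of_nonneg (by linarith) h5).trans hX0

end Bounds

/-! ### The two bounds combined. -/

theorem asympAAS_improperChromaticNumber (p : unitInterval) (hp0 : 0 < (p : ℝ))
    (hp1 : (p : ℝ) < 1) {t : ℕ → ℝ} (ht : ∀ n : ℕ, 0 ≤ t n) {τ : ℝ} (hτ : 0 ≤ τ)
    (hlim : Tendsto (fun n : ℕ => t n / Real.log n) atTop (𝓝 τ)) :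
    AsympAAS p (fun n G => (improperChromaticNumber G (t n) : ℝ))
      (fun n : ℕ => (n : ℝ) / (kappa (p : ℝ) τ * Real.log n)) := by
  intro ε hε
  obtain ⟨hκτ, hlow, -, hhigh⟩ := kappa_spec hp0 hp1 hτ
  set κ := kappa (p : ℝ) τ with hκdef
  have hτp : 0 ≤ τ / p := by positivity
  have hκ : 0 < κ := hτp.trans_lt hκτ
  -- Below κ for existence, above τ/p for the rate condition to be available, and above κ/(1+ε) so
  -- that the number of colours loses less than a factor 1+ε.
  obtain ⟨κ₁, hκ₁, hκ₁κ⟩ : ∃ κ₁, max (τ / p) (κ / (1 + ε)) < κ₁ ∧ κ₁ < κ :=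
    exists_between (max_lt hκτ (div_lt_self hκ (by linarith)))
  rw [max_lt_iff] at hκ₁
  have hκ₂ : κ < κ * (1 + ε) := by nlinarith
  have hP₁ := tendsto_bprob_exists_not_dependent hp0 hp1 hτ hκ₁.1 (hlow κ₁ hκ₁.1 hκ₁κ) ht hlim
  have hP₂ := tendsto_bprob_exists_dependent hp0 hp1 hτ (hκτ.trans hκ₂) (hhigh _ hκ₂) hlim
  have hP := (ENNReal.tendsto_ofReal hP₁).add (ENNReal.tendsto_ofReal hP₂)
  have hsub := ENNReal.Tendsto.sub (tendsto_const_nhds (x := (1 : ENNReal))) hP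
    (Or.inl ENNReal.one_ne_top)
  simp only [ENNReal.ofReal_zero, add_zero, tsub_zero] at hsub
  refine tendsto_of_tendsto_of_tendsto_of_le_of_le' hsub tendsto_const_nhds ?_
    (.of_forall fun n => prob_le_one)
  filter_upwards [eventually_improperChromaticNumber_le (ε := ε) hκ (hτp.trans_lt hκ₁.1)
    (by have := (div_lt_iff₀ (by linarith)).1 hκ₁.2; linarith) ht,
    tendsto_log_natCast.eventually_gt_atTop 0] with n hn hx
  rw [tsub_le_iff_right]
  have hunion : (Set.univ : Set (SimpleGraph (Fin n))) ⊆
      {G | (1 - ε) * (n / (κ * Real.log n)) ≤ (improperChromaticNumber G (t n) : ℝ) ∧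
        (improperChromaticNumber G (t n) : ℝ) ≤ (1 + ε) * (n / (κ * Real.log n))} ∪
      ({G | ∃ W : Finset (Fin n), (n : ℝ) ≤ #W * Real.log n ^ 2 ∧
        ∀ S ∈ W.powersetCard ⌊κ₁ * Real.log n⌋₊, ¬ IsDependentIn (t n) (edges G) S} ∪
      {G | ∃ S : Finset (Fin n), #S = ⌊κ * (1 + ε) * Real.log n⌋₊ + 1 ∧
        IsDependentIn (t n) (edges G) S}) := by
    intro G _
    by_contra hG
    rw [Set.mem_union, Set.mem_union, not_or, not_or] at hG
    obtain ⟨h1, h2, h3⟩ := hG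
    simp only [Set.mem_ofPred_eq, not_exists, not_and, not_forall, not_not] at h2 h3
    refine h1 ⟨le_improperChromaticNumber hκ hε (ht n) hx G h3, hn G fun W hW => ?_⟩
    obtain ⟨S, hS, h⟩ := h2 W hW
    exact ⟨S, hS, h⟩
  calc (1 : ENNReal) = SimpleGraph.binomialRandom (Fin n) p Set.univ := measure_univ.symm
    _ ≤ _ := measure_mono hunion
    _ ≤ _ := measure_union_le _ _
    _ ≤ _ := by
      gcongr
      refine (measure_union_le _ _).trans ?_
      gcongr
      · exact binomialRandom_le_bprob p fun G hG => hG
      · exact binomialRandom_le_bprob p fun G hG => hG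

end ImproperColouring

theorem lemma8 (p : unitInterval) (hp0 : 0 < (p : ℝ)) (hp1 : (p : ℝ) < 1)
    (t : ℕ → ℝ) (ht : ∀ n : ℕ, 0 ≤ t n) (τ : ℝ) (hτ : 0 ≤ τ)
    (hlim : Tendsto (fun n : ℕ => t n / Real.log n) atTop (𝓝 τ)) :
    ImproperColouring.AsympAAS p
      (fun n G => (ImproperColouring.improperChromaticNumber G (t n) : ℝ))
      (fun n : ℕ => (n : ℝ) / (ImproperColouring.kappa (p : ℝ) τ * Real.log n)) :=
  ImproperColouring.asympAAS_improperChromaticNumber p hp0 hp1 ht hτ hlim
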